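/- **Theorem 2.1.** Let $n\ge 1$, and let $\lambda\in\mathbb C\setminus(-\infty,0]$ or, if $n\ge 2$, $\lambda=0$. Let $$\kappa_\lambda(x)=\frac{1}{(2\pi)^{n/2}}\Big(\frac{|x|}{\lambda}\Big)^{1-n/2}K_{n/2-1}(\lambda|x|)\quad(\lambda\neq0),$$ where $K_\nu$ is the modified Bessel function of the second kind, and $$\kappa_0(x)=\frac1{2\pi}\log\frac1{|x|}\ (n=2),\qquad \kappa_0(x)=\frac{\Gamma(\frac n2-1)}{4\pi^{n/2}}\frac1{|x|^{n-2}}\ (n\ge3).$$ Let $\Omega\subset\mathbb R^n$ be a bounded non-empty open set with $C^2$ boundary, and let $\eta\in\mathcal S(\mathbb R^n)$ satisfy, for some $N\ge2$, $$\int_{\mathbb R^n}\eta(x)\,x^\alpha\,dx=\delta_{0,\alpha},\qquad 0\le|\alpha|<N .$$ If $\operatorname{Re}\lambda<0$, assume in addition that $|\eta(x)|\le Ae^{-\sigma|x|}$ for some $A,\sigma>0$. For $f\in C^N(\Omega)$ put $\mathcal K_\lambda f(x)=\int_\Omega\kappa_\lambda(x-y)f(y)\,dy$, and let $\widetilde f\in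 C^N_0(\mathbb R^n)$ be an extension of $f$ with $\|\widetilde f\|_{W^N_\infty(\mathbb R^n)}\le C_E\|f\|_{W^N_\infty(\Omega)}$. For $h,\mathcal D,r>0$ define $$\widetilde{\mathcal K}_{\lambda,h}\widetilde f(x)=\mathcal D^{-n/2}\sum_{m\in\mathbb Z^n,\ d(hm,\Omega)\le rh\sqrt{\mathcal D}}\widetilde f(hm)\int_{T_{hm}}\kappa_\lambda(x-y)\,\eta\Big(\frac{y-hm}{h\sqrt{\mathcal D}}\Big)dy,$$ where $T_{hm}$ is the half-space bounded by the tangent hyperplane to $\partial\Omega$ at a point $P_{hm}\in\partial\Omega$ of minimal distance to $hm$, lying on the side of the inner normal of $\Omega$ at $P_{hm}$. Let $X\subset\mathbb R^n$ be bounded; if $\operatorname{Re}\lambda\ge0$ and $(n,\lambda)\ne(2,0)$, then $X\subset\mathbb R^n$ may be arbitrary, for instance $X=\mathbb R^n$. There are constants $c_1>0$ and $s_0>0$, depending only on $n,N,\lambda,\Omega,\eta,C_E,X$, such that for every $\varepsilon>0$ there are $r_0>0$ and $\mathcal D_0>0$ with the following property: for all $r\ge r_0$, all $\mathcal D\ge\mathcal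 D_0$, all $h>0$ with $h\sqrt{\mathcal D}\le s_0$, all $f$ and $\widetilde f$ as above, all choices of the nearest points $P_{hm}$, and all $x\in X$, the integrals defining $\mathcal K_\lambda f(x)$ and $\widetilde{\mathcal K}_{\lambda,h}\widetilde f(x)$ converge absolutely and $$\big|\widetilde{\mathcal K}_{\lambda,h}\widetilde f(x)-\mathcal K_\lambda f(x)\big|\le\big(\varepsilon+c_1(h\sqrt{\mathcal D})^2\big)\,\|f\|_{W^N_\infty(\Omega)} .$$ -/

import Mathlib

open MeasureTheory Set
open scoped SchwartzMap RealInnerProductSpace ENNReal NNReal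

noncomputable section

/-- `ℝⁿ` with its Euclidean norm. -/
abbrev Euc (n : ℕ) := EuclideanSpace ℝ (Fin n)

/-- The modified Bessel function of the second kind `K_ν(z)`, `ν` real, `z ∈ ℂ ∖ (-∞, 0]`, through
the Laplace-type integral representation
`K_ν(z) = √(π/(2z)) e^{-z} / Γ(ν + 1/2) · ∫₀^∞ e^{-u} u^{ν-1/2} (1 + u/(2z))^{ν-1/2} du`,
which is valid for `ν > -1/2` on the whole cut plane `|arg z| < π`; for negative orders one uses
`K_{-ν} = K_ν`. All powers are principal. -/
def besselK (ν : ℝ) (z : ℂ) : ℂ :=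
  ((Real.pi : ℂ) / (2 * z)) ^ (1 / 2 : ℂ) * Complex.exp (-z) / (Real.Gamma (|ν| + 1 / 2) : ℂ) *
    ∫ u in Ioi (0 : ℝ),
      ((Real.exp (-u) * u ^ (|ν| - 1 / 2) : ℝ) : ℂ) *
        (1 + (u : ℂ) / (2 * z)) ^ ((|ν| - 1 / 2 : ℝ) : ℂ)

/-- The fundamental solution `κ_lam` of `-Δ + lam²` in `ℝⁿ`:
* `lam ≠ 0`: `(2π)^{-n/2} (|x|/lam)^{1-n/2} K_{n/2-1}(lam |x|)`;
* `lam = 0`, `n = 2`: `(2π)⁻¹ log (1/|x|)`;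
* `lam = 0`, `n ≥ 3`: `Γ(n/2-1) / (4 π^{n/2}) · |x|^{2-n}`.
(The case `lam = 0`, `n ≤ 1` is never used. The value at `x = 0` is irrelevant.) -/
def fundSol {n : ℕ} (lam : ℂ) (x : Euc n) : ℂ :=
  if lam = 0 then
    if n = 2 then ((1 / (2 * Real.pi) * Real.log (1 / ‖x‖) : ℝ) : ℂ)
    else ((Real.Gamma ((n : ℝ) / 2 - 1) / (4 * Real.pi ^ ((n : ℝ) / 2)) *
      (1 / ‖x‖ ^ ((n : ℝ) - 2)) : ℝ) : ℂ)
  else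
    ((1 / (2 * Real.pi) ^ ((n : ℝ) / 2) : ℝ) : ℂ) *
      (((‖x‖ : ℝ) : ℂ) / lam) ^ ((1 - (n : ℝ) / 2 : ℝ) : ℂ) *
      besselK ((n : ℝ) / 2 - 1) (lam * ((‖x‖ : ℝ) : ℂ))

/-- The volume potential `∫_Ω κ_lam(x - y) f(y) dy`. -/
def volPotential {n : ℕ} (lam : ℂ) (Ω : Set (Euc n)) (f : Euc n → ℂ) (x : Euc n) : ℂ :=
  ∫ y in Ω, fundSol lam (x - y) * f y

/-- `ν` is the unit normal at the boundary point `p` directed towards the interior of `Ω`, `∂Ω`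
being of class `C²` near `p`: in Cartesian coordinates centred at `p`, with last axis along `ν`,
the set `Ω` is given near `p` by `y_n > φ(y')` with `φ` of class `C²`, `φ(0) = 0`, `∇φ(0) = 0`.
Here `y_n = ⟪ν, x - p⟫` and `y' = (x - p) - y_n ν`; only the values of `φ` on the hyperplane
orthogonal to `ν` matter. -/
structure IsInnerUnitNormal {n : ℕ} (Ω : Set (Euc n)) (p ν : Euc n) : Prop where
  norm_eq : ‖ν‖ = 1
  graph : ∃ φ : Euc n → ℝ, ContDiff ℝ 2 φ ∧ φ 0 = 0 ∧ fderiv ℝ φ 0 = 0 ∧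
    ∃ δ > (0 : ℝ), ∀ x ∈ Metric.ball p δ,
      (x ∈ Ω ↔ φ ((x - p) - ⟪ν, x - p⟫ • ν) < ⟪ν, x - p⟫)

/-- `∂Ω` is of class `C²`: near each of its points, `Ω` is the region above the graph of a `C²`
function (taken over the tangent hyperplane at that point). -/
def HasC2Boundary {n : ℕ} (Ω : Set (Euc n)) : Prop :=
  ∀ p ∈ frontier Ω, ∃ ν, IsInnerUnitNormal Ω p ν

/-- The halfspace bounded by the hyperplane through `p` orthogonal to `ν`, on the side of `ν`. -/
def halfSpace {n : ℕ} (p ν : Euc n) : Set (Euc n) := {y | 0 < ⟪ν, y - p⟫}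

/-- The moment conditions of order `N`: `∫ η(x) x^α dx = δ_{0,α}` for all `|α| < N`. -/
def MomentCondition {n : ℕ} (N : ℕ) (η : Euc n → ℂ) : Prop :=
  ∀ α : Fin n → ℕ, ∑ i, α i < N →
    ∫ x : Euc n, η x * ((∏ i, x i ^ α i : ℝ) : ℂ) = if α = 0 then 1 else 0

/-- The norm of `W^N_∞(S)` for a function of class `C^N` on the open set `S`: the supremum over
`S` of the norms of all derivatives of order at most `N`. -/
def sobolevSupNorm {n : ℕ} (N : ℕ) (S : Set (Euc n)) (g : Euc n → ℂ) : ℝ≥0∞ :=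
  ⨆ (k : ℕ) (_ : k ≤ N) (x : Euc n) (_ : x ∈ S), ‖iteratedFDeriv ℝ k g x‖ₑ

/-- The node `h m` of the uniform grid of step `h`. -/
def gridPoint {n : ℕ} (h : ℝ) (m : Fin n → ℤ) : Euc n := WithLp.toLp 2 fun i => h * (m i : ℝ)

/-- The indices `m` of the nodes with `d(h m, Ω) ≤ r h √D` (finitely many if `Ω` is bounded). -/
def nodes {n : ℕ} (Ω : Set (Euc n)) (h D r : ℝ) : Set (Fin n → ℤ) :=
  {m | Metric.infDist (gridPoint h m) Ω ≤ r * (h * √D)}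

/-- The scaled translate `y ↦ η((y - h m) / (h √D))`. -/
def scaledShift {n : ℕ} (η : Euc n → ℂ) (h D : ℝ) (m : Fin n → ℤ) (y : Euc n) : ℂ :=
  η ((h * √D)⁻¹ • (y - gridPoint h m))

/-- For each node `h m`, `P m` is a point of `∂Ω` at minimal distance from `h m`, and `ν m` is the
inner unit normal there. -/
def IsNearestBoundaryData {n : ℕ} (Ω : Set (Euc n)) (h : ℝ) (P ν : (Fin n → ℤ) → Euc n) : Prop :=
  ∀ m, P m ∈ frontier Ω ∧
    dist (gridPoint h m) (P m) = Metric.infDist (gridPoint h m) (frontier Ω) ∧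
    IsInnerUnitNormal Ω (P m) (ν m)

/-- The cubature formula
`D^{-n/2} ∑_{d(hm,Ω) ≤ r h √D} F(hm) ∫_{T_{hm}} κ_lam(x - y) η((y - hm)/(h √D)) dy`,
where `T_{hm}` is the halfspace through `P m` with inner normal `ν m`. -/
def cubature {n : ℕ} (lam : ℂ) (Ω : Set (Euc n)) (η F : Euc n → ℂ) (h D r : ℝ)
    (P ν : (Fin n → ℤ) → Euc n) (x : Euc n) : ℂ :=
  ((D ^ (-(n : ℝ) / 2) : ℝ) : ℂ) *
    ∑ᶠ m ∈ nodes Ω h D r, F (gridPoint h m) *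
      ∫ y in halfSpace (P m) (ν m), fundSol lam (x - y) * scaledShift η h D m y

end

/-!
Put `s = h √D` and `w_m(y) = D^{-n/2} η((y - hm)/s)`. The error is `∫ κ(x - y) E(y) dy` with density
error `E = ∑_m F(hm) w_m 1_{T_m} - 1_Ω f`, and `E` splits into two parts.

*Quasi-interpolation.* Inside `Ω` one compares `∑_m F(hm) w_m` with `F`. Taylor expansion of `F` at
`y` to second order reduces this to lattice sums of `η`, of `x_i η` and of `|x|² |η|`. The first two
are Riemann sums of mesh `D^{-1/2}`, hence tend to their integrals `1` and `0` uniformly in the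
position of the lattice as `D → ∞`; the third contributes `O(s²)`; the omitted nodes are further
than `r s` from `y` and are negligible for large `r`
(`exists_norm_quasiInterpolant_sub_le`). Only the moments of order at most one matter, because an
error of order `s²` is allowed anyway.

*Mismatch of the half-spaces.* The node `hm` contributes at `y` only if `T_m` and `Ω` disagree on
`y`. The ball about `hm` touching `∂Ω` at `P_m` lies on the correct side of both, so that
`|y - P_m| ≤ 2 |y - hm|` (`dist_le_two_mul_of_not_iff`), and as `∂Ω` is `C²` and compact,
`d(y, ∂Ω) ≤ C |y - P_m|²` with a uniform `C` (`exists_infDist_frontier_le_sq`). So such nodes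
satisfy `|y - hm|/s ≥ c √d(y, ∂Ω)/s`, and their total weight is at most
`C (1 + d(y, ∂Ω)/s²)^{-(n+2)}` (`exists_sum_mismatch_le`). Integrating against the kernel gives `O(s²)`
(`exists_lintegral_decay_le`), because the layer `{d(·, ∂Ω) ≤ t}` carries only `O(t)` of the
potential, uniformly in `x`. The last fact follows from the volume bound `O(t r^{n-1})` for the part
of the layer in a ball of radius `r`: a local defining function grows at unit speed along the
normal, so a slab has about `r/t` disjoint translates in a ball of radius `O(r)`
(`volume_slab_inter_ball_le`).

The kernel enters only through `‖κ(z)‖ ≤ C (∑_j 2^{j(n-3/2)} 1_{|z| < 2·2^{-j}} + G(|z|))` with `G`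
bounded, linear or exponential. For `x ∈ X` the growth is expressed by a submultiplicative function
`ω` of `d(y, ∂Ω)/(2 s₀)`; since `|y - hm|/s ≥ d(y, ∂Ω)/(2 s₀)` at a mismatch, it is absorbed by the
decay of `η`, provided that `s₀` is small when `Re lam < 0` (`exists_growthRate`).
-/

section

open Filter Topology Metric

/-! ### Defining functions of a `C²` domain and touching balls -/

/-- A `C²` function `ρ` on the whole space that defines `Ω` in the ball of radius `δ` about the
boundary point `p`: `Ω` is `{ρ > 0}` there. It is normalised to grow at unit speed along the inner
normal `ν` at `p`, so that it can be compared with the distance from `∂Ω`. -/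
structure IsLocalDefining {n : ℕ} (Ω : Set (Euc n)) (p ν : Euc n) (ρ : Euc n → ℝ) (δ : ℝ) :
    Prop where
  norm_eq : ‖ν‖ = 1
  contDiff : ContDiff ℝ 2 ρ
  add_smul : ∀ y (t : ℝ), ρ (y + t • ν) = ρ y + t
  pos : 0 < δ
  mem_iff : ∀ y ∈ ball p δ, (y ∈ Ω ↔ 0 < ρ y)
  apply_self : ρ p = 0
  hasFDerivAt : HasFDerivAt ρ (innerSL ℝ ν) p

lemma IsInnerUnitNormal.exists_isLocalDefining {n : ℕ} {Ω : Set (Euc n)} {p ν : Euc n}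
    (h : IsInnerUnitNormal Ω p ν) : ∃ ρ δ, IsLocalDefining Ω p ν ρ δ := by
  obtain ⟨hν, φ, hφ, h0, hd, δ, hδ, hm⟩ := h
  refine ⟨fun y => ⟪ν, y - p⟫ - φ ((y - p) - ⟪ν, y - p⟫ • ν), δ, hν, ?_, ?_, hδ, ?_, ?_, ?_⟩
  · have e : ContDiff ℝ 2 fun y : Euc n => ⟪ν, y - p⟫ :=
      (innerSL ℝ ν).contDiff.comp (contDiff_id.sub contDiff_const)
    exact e.sub (hφ.comp ((contDiff_id.sub contDiff_const).sub (e.smul contDiff_const)))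
  · intro y t
    have h1 : ⟪ν, y + t • ν - p⟫ = ⟪ν, y - p⟫ + t := by
      rw [show y + t • ν - p = (y - p) + t • ν by abel, inner_add_right, real_inner_smul_right,
        real_inner_self_eq_norm_sq, hν]; ring
    have h2 : (y + t • ν - p) - ⟪ν, y + t • ν - p⟫ • ν = (y - p) - ⟪ν, y - p⟫ • ν := by
      rw [h1, add_smul]; abel
    rw [h2, h1]; ring
  · intro y hy
    rw [hm y hy, sub_pos]
  · simp [h0]
  · have e1 : HasFDerivAt (fun y : Euc n => ⟪ν, y - p⟫) (innerSL ℝ ν) p := by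
      have : HasFDerivAt (fun y : Euc n => innerSL ℝ ν y - innerSL ℝ ν p) (innerSL ℝ ν) p :=
        (innerSL ℝ ν).hasFDerivAt.sub_const _
      simpa [inner_sub_right] using this
    have e2 : HasFDerivAt (fun y : Euc n => (y - p) - ⟪ν, y - p⟫ • ν)
        (ContinuousLinearMap.id ℝ _ - (innerSL ℝ ν).smulRight ν) p :=
      ((hasFDerivAt_id p).sub_const p).sub (e1.smul_const ν)
    have e3 : HasFDerivAt φ (0 : Euc n →L[ℝ] ℝ) ((p - p) - ⟪ν, p - p⟫ • ν) := by
      have := (hφ.differentiable (by norm_num) 0).hasFDerivAt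
      rw [hd] at this
      simpa using this
    have e4 : HasFDerivAt (fun y : Euc n => φ ((y - p) - ⟪ν, y - p⟫ • ν))
        (0 : Euc n →L[ℝ] ℝ) p := by
      have := e3.comp p e2
      rwa [ContinuousLinearMap.zero_comp] at this
    have := e1.sub e4
    rwa [sub_zero] at this

/-- Two covectors inducing compatible half-spaces are positively proportional. -/
lemma eq_norm_smul_of_inner_nonneg {E : Type*} [NormedAddCommGroup E] [InnerProductSpace ℝ E]
    {g ν : E} (hν : ‖ν‖ = 1) (h : ∀ v, 0 < ⟪g, v⟫ → 0 ≤ ⟪ν, v⟫) : g = ‖g‖ • ν := by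
  by_cases hg : g = 0
  · simp [hg]
  have hg' : 0 < ‖g‖ := norm_pos_iff.2 hg
  by_contra hne
  have hlt : ⟪g, ν⟫ < ‖g‖ := by
    have h1 : ⟪g, ν⟫ ≤ ‖g‖ * ‖ν‖ := real_inner_le_norm g ν
    rw [hν, mul_one] at h1
    refine lt_of_le_of_ne h1 fun he => hne ?_
    have := (inner_eq_norm_mul_iff_real (x := g) (y := ν)).1 (by rw [he, hν, mul_one])
    simpa [hν] using this
  have h2 := h (g - ‖g‖ • ν) (by
    rw [inner_sub_right, real_inner_smul_right, real_inner_self_eq_norm_sq]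
    nlinarith)
  rw [inner_sub_right, real_inner_smul_right, real_inner_self_eq_norm_sq, hν,
    real_inner_comm] at h2
  linarith

/-- The derivative at a zero of `ρ`, as a one-sided limit of difference quotients; it transports
signs of `ρ` along half-lines to signs of the derivative. -/
lemma tendsto_inv_mul_of_hasFDerivAt {n : ℕ} {ρ : Euc n → ℝ} {L : Euc n →L[ℝ] ℝ} {p : Euc n}
    (h : HasFDerivAt ρ L p) (h0 : ρ p = 0) (v : Euc n) :
    Tendsto (fun t : ℝ => t⁻¹ * ρ (p + t • v)) (𝓝[>] 0) (𝓝 (L v)) := by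
  have h1 : HasDerivAt (fun t : ℝ => ρ (p + t • v)) (L v) 0 := h.hasLineDerivAt v
  simpa [h0] using h1.tendsto_slope_zero_right

lemma tendsto_add_smul_right {n : ℕ} (p v : Euc n) :
    Tendsto (fun t : ℝ => p + t • v) (𝓝[>] 0) (𝓝 p) := by
  have : Tendsto (fun t : ℝ => p + t • v) (𝓝 0) (𝓝 (p + (0 : ℝ) • v)) :=
    Continuous.tendsto (by fun_prop) 0
  simpa using this.mono_left nhdsWithin_le_nhds

namespace IsLocalDefining
variable {n : ℕ} {Ω : Set (Euc n)} {p ν : Euc n} {ρ : Euc n → ℝ} {δ : ℝ}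

lemma eq_zero_of_mem_frontier (h : IsLocalDefining Ω p ν ρ δ) (hΩ : IsOpen Ω) {y : Euc n}
    (hy : y ∈ ball p δ) (hf : y ∈ frontier Ω) : ρ y = 0 := by
  rw [hΩ.frontier_eq] at hf
  refine le_antisymm (not_lt.1 fun h1 => hf.2 ((h.mem_iff y hy).2 h1)) (not_lt.1 fun h1 => ?_)
  have h2 : ∀ᶠ z in 𝓝 y, z ∉ Ω := by
    filter_upwards [isOpen_ball.mem_nhds hy,
      (h.contDiff.continuous.continuousAt (x := y)).eventually_lt_const h1] with z hz hz'
    rw [h.mem_iff z hz]; exact not_lt.2 hz'.le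
  exact (mem_closure_iff_frequently.1 hf.1) h2

lemma mem_frontier_of_eq_zero (h : IsLocalDefining Ω p ν ρ δ) (hΩ : IsOpen Ω) {y : Euc n}
    (hy : y ∈ ball p δ) (h0 : ρ y = 0) : y ∈ frontier Ω := by
  rw [hΩ.frontier_eq]
  refine ⟨?_, fun h1 => by rw [h.mem_iff y hy, h0] at h1; exact lt_irrefl _ h1⟩
  refine mem_closure_of_tendsto (tendsto_add_smul_right y ν) ?_
  filter_upwards [(tendsto_add_smul_right y ν).eventually (isOpen_ball.mem_nhds hy),
    self_mem_nhdsWithin] with t ht ht'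
  rw [h.mem_iff _ ht, h.add_smul, h0, zero_add]; exact ht'

/-- The inner normal at a boundary point is the normalised gradient of any defining function. -/
lemma fderiv_apply_eq (h : IsLocalDefining Ω p ν ρ δ) (hΩ : IsOpen Ω) {q μ : Euc n}
    (hq : q ∈ ball p δ) (hf : q ∈ frontier Ω) (hμ : IsInnerUnitNormal Ω q μ) :
    ∃ c ≥ 0, ∀ v, fderiv ℝ ρ q v = c * ⟪μ, v⟫ := by
  obtain ⟨ρ', δ', h'⟩ := hμ.exists_isLocalDefining
  have hd : HasFDerivAt ρ (fderiv ℝ ρ q) q :=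
    (h.contDiff.differentiable (by norm_num) q).hasFDerivAt
  have h0 := h.eq_zero_of_mem_frontier hΩ hq hf
  obtain ⟨g, hg⟩ : ∃ g, ∀ v, fderiv ℝ ρ q v = ⟪g, v⟫ :=
    ⟨(InnerProductSpace.toDual ℝ (Euc n)).symm (fderiv ℝ ρ q), fun v => by simp⟩
  have key : g = ‖g‖ • μ := by
    refine eq_norm_smul_of_inner_nonneg h'.norm_eq fun v hv => ?_
    rw [← hg] at hv
    refine ge_of_tendsto (tendsto_inv_mul_of_hasFDerivAt h'.hasFDerivAt h'.apply_self v) ?_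
    filter_upwards [(tendsto_add_smul_right q v).eventually (isOpen_ball.mem_nhds hq),
      (tendsto_add_smul_right q v).eventually (ball_mem_nhds q h'.pos), self_mem_nhdsWithin,
      (tendsto_inv_mul_of_hasFDerivAt hd h0 v).eventually_const_lt hv] with t h1 h2 h3 h4
    have h3' : (0 : ℝ) < t := h3
    have h5 : 0 < ρ (q + t • v) := by
      by_contra h6
      exact absurd h4 (not_lt.2 (mul_nonpos_of_nonneg_of_nonpos (by positivity) (not_lt.1 h6)))
    have h6 := (h'.mem_iff _ h2).1 ((h.mem_iff _ h1).2 h5)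
    positivity
  refine ⟨‖g‖, norm_nonneg _, fun v => ?_⟩
  rw [hg]; nth_rw 1 [key]; rw [real_inner_smul_left]

end IsLocalDefining

/-- If an open ball touching `∂Ω` at `p` lies in `Ω` or outside of it, the half-space at `p`
treats the points of the ball like `Ω` does. -/
lemma mem_halfSpace_iff_of_dist_lt {n : ℕ} {Ω : Set (Euc n)} {p ν q y : Euc n}
    (hΩ : IsOpen Ω) (hν : IsInnerUnitNormal Ω p ν) (hq : dist q p = infDist q (frontier Ω))
    (hy : dist y q < dist q p) : y ∈ halfSpace p ν ↔ y ∈ Ω := by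
  obtain ⟨ρ, δ, h⟩ := hν.exists_isLocalDefining
  have hball : Disjoint (ball q (dist q p)) (frontier Ω) := by
    rw [hq]; exact disjoint_ball_infDist
  have hin : ∀ v, 0 < ⟪q - p, v⟫ → ∀ᶠ t : ℝ in 𝓝[>] 0, p + t • v ∈ ball q (dist q p) := by
    intro v hv
    have h1 : ∀ᶠ t : ℝ in 𝓝[>] 0, t * ‖v‖ ^ 2 < 2 * ⟪q - p, v⟫ := by
      have : Tendsto (fun t : ℝ => t * ‖v‖ ^ 2) (𝓝[>] 0) (𝓝 (0 * ‖v‖ ^ 2)) :=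
        (Continuous.tendsto (by fun_prop) 0).mono_left nhdsWithin_le_nhds
      exact this.eventually_lt_const (by linarith)
    filter_upwards [h1, self_mem_nhdsWithin] with t ht ht'
    have ht' : (0 : ℝ) < t := ht'
    rw [mem_ball, dist_comm, dist_eq_norm, dist_eq_norm]
    refine lt_of_pow_lt_pow_left₀ 2 (norm_nonneg _) ?_
    rw [show q - (p + t • v) = (q - p) - t • v by abel, norm_sub_sq_real, real_inner_smul_right,
      norm_smul, mul_pow, Real.norm_eq_abs, sq_abs]
    nlinarith
  have hpos : 0 < ⟪q - p, y - p⟫ := by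
    have h1 : dist y q ^ 2 < dist q p ^ 2 := by gcongr
    rw [dist_eq_norm, dist_eq_norm, show y - q = (y - p) - (q - p) by abel,
      norm_sub_sq_real] at h1
    rw [real_inner_comm]
    nlinarith [sq_nonneg ‖y - p‖]
  have hn : 0 < ‖q - p‖ := by
    rw [← dist_eq_norm]; exact dist_nonneg.trans_lt hy
  have hpre : IsPreconnected (ball q (dist q p)) := (convex_ball _ _).isPreconnected
  have hyb : y ∈ ball q (dist q p) := hy
  have hcase : ball q (dist q p) ⊆ Ω ∨ ball q (dist q p) ⊆ Ωᶜ := by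
    by_contra! hc
    obtain ⟨z, hz, hz'⟩ := not_subset.1 hc.1
    obtain ⟨w, hw, hw'⟩ := not_subset.1 hc.2
    have hcov : ∀ u ∈ ball q (dist q p), u ∉ Ω → u ∈ (closure Ω)ᶜ := fun u hu hu' hcl =>
      hball.ne_of_mem hu (by rw [hΩ.frontier_eq]; exact ⟨hcl, hu'⟩) rfl
    obtain ⟨u, -, hu, hu'⟩ := hpre Ω (closure Ω)ᶜ hΩ isClosed_closure.isOpen_compl
      (fun u hu => or_iff_not_imp_left.2 (hcov u hu)) ⟨w, hw, not_not.1 hw'⟩ ⟨z, hz, hcov z hz hz'⟩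
    exact hu' (subset_closure hu)
  have hnear : ∀ v, ∀ᶠ t : ℝ in 𝓝[>] 0, p + t • v ∈ ball p δ := fun v =>
    (tendsto_add_smul_right p v).eventually (ball_mem_nhds p h.pos)
  rcases hcase with hc | hc
  · have e : q - p = ‖q - p‖ • ν := by
      refine eq_norm_smul_of_inner_nonneg h.norm_eq fun v hv => ?_
      refine ge_of_tendsto (tendsto_inv_mul_of_hasFDerivAt h.hasFDerivAt h.apply_self v) ?_
      filter_upwards [hin v hv, hnear v, self_mem_nhdsWithin] with t h1 h2 h3
      have h3 : (0 : ℝ) < t := h3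
      have := (h.mem_iff _ h2).1 (hc h1)
      positivity
    refine ⟨fun _ => hc hyb, fun _ => ?_⟩
    rw [e, real_inner_smul_left] at hpos
    exact pos_of_mul_pos_right hpos hn.le
  · have e : q - p = ‖q - p‖ • (-ν) := by
      refine eq_norm_smul_of_inner_nonneg (by rw [norm_neg, h.norm_eq]) fun v hv => ?_
      rw [inner_neg_left, neg_nonneg]
      refine le_of_tendsto (tendsto_inv_mul_of_hasFDerivAt h.hasFDerivAt h.apply_self v) ?_
      filter_upwards [hin v hv, hnear v, self_mem_nhdsWithin] with t h1 h2 h3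
      have h3 : (0 : ℝ) < t := h3
      have := mt (h.mem_iff _ h2).2 (hc h1)
      exact mul_nonpos_of_nonneg_of_nonpos (by positivity) (not_lt.1 this)
    refine ⟨fun h1 => ?_, fun h1 => absurd h1 (hc hyb)⟩
    rw [e, real_inner_smul_left] at hpos
    have h2 := pos_of_mul_pos_right hpos hn.le
    rw [inner_neg_left] at h2
    have h1 : 0 < ⟪ν, y - p⟫ := h1
    linarith

/-- A point on which the half-space and `Ω` disagree is outside the touching ball about `q`, so its
distance from `p` is controlled by its distance from `q`, however far `q` is from `∂Ω`. -/
lemma dist_le_two_mul_of_not_iff {n : ℕ} {Ω : Set (Euc n)} {p ν q y : Euc n}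
    (hΩ : IsOpen Ω) (hν : IsInnerUnitNormal Ω p ν) (hq : dist q p = infDist q (frontier Ω))
    (hy : ¬ (y ∈ halfSpace p ν ↔ y ∈ Ω)) : dist y p ≤ 2 * dist y q := by
  have h1 : dist q p ≤ dist y q :=
    not_lt.1 fun h => hy (mem_halfSpace_iff_of_dist_lt hΩ hν hq h)
  linarith [dist_triangle y q p]

/-! ### Tangent half-spaces and boundary layers -/

namespace IsLocalDefining
variable {n : ℕ} {Ω : Set (Euc n)} {p ν : Euc n} {ρ : Euc n → ℝ} {δ : ℝ}

/-- Near `p`, a point `y` on which `Ω` and the half-space tangent at `q` disagree satisfies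
`|ρ y| ≤ C |y - q|²`, as `ρ` and its linearisation at `q` have opposite signs; moving `y` along `ν`
by `-ρ y` then reaches `∂Ω`. -/
lemma exists_infDist_le_sq (h : IsLocalDefining Ω p ν ρ δ) (hΩ : IsOpen Ω) :
    ∃ ε > 0, ∃ C : ℝ, ∀ q ∈ ball p ε, q ∈ frontier Ω → ∀ μ, IsInnerUnitNormal Ω q μ →
      ∀ y ∈ ball p ε, ¬ (y ∈ halfSpace q μ ↔ y ∈ Ω) →
        infDist y (frontier Ω) ≤ C * dist y q ^ 2 := by
  have hdiff : Differentiable ℝ ρ := h.contDiff.differentiable (by norm_num)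
  obtain ⟨K, t, ht, hK⟩ : ∃ K, ∃ t ∈ 𝓝 p, LipschitzOnWith K (fderiv ℝ ρ) t :=
    ContDiffAt.exists_lipschitzOnWith
      (h.contDiff.fderiv_right (m := 1) (by norm_num)).contDiffAt
  obtain ⟨ε₁, hε₁, hb₁⟩ := Metric.mem_nhds_iff.1 ht
  have h2 : ∀ᶠ y in 𝓝 p, |ρ y| < δ / 2 := by
    have := (h.contDiff.continuous.abs.continuousAt (x := p))
    refine this.eventually_lt_const ?_
    simp only [h.apply_self, abs_zero]; linarith [h.pos]
  obtain ⟨ε₂, hε₂, hb₂⟩ := Metric.eventually_nhds_iff_ball.1 h2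
  refine ⟨min (min ε₁ ε₂) (δ / 2), by have := h.pos; positivity, K,
    fun q hq hqf μ hμ y hy hne => ?_⟩
  have hs : ∀ z ∈ ball p (min (min ε₁ ε₂) (δ / 2)), dist z p < ε₁ ∧ dist z p < ε₂ ∧
      dist z p < δ / 2 := by
    intro z hz; simpa [and_assoc] using hz
  have hδ := h.pos
  have hqδ : q ∈ ball p δ := by rw [mem_ball]; linarith [(hs q hq).2.2]
  have hyδ : y ∈ ball p δ := by rw [mem_ball]; linarith [(hs y hy).2.2]
  have hq0 := h.eq_zero_of_mem_frontier hΩ hqδ hqf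
  obtain ⟨c, hc, hcv⟩ := h.fderiv_apply_eq hΩ hqδ hqf hμ
  have taylor : ‖ρ y - ρ q - fderiv ℝ ρ q (y - q)‖ ≤ K * dist y q * ‖y - q‖ := by
    refine Convex.norm_image_sub_le_of_norm_fderiv_le' (𝕜 := ℝ)
      (s := ball p ε₁ ∩ closedBall q (dist y q)) (fun z _ => hdiff z) ?_
      ((convex_ball _ _).inter (convex_closedBall _ _)) ?_ ?_
    · intro z hz
      rw [← dist_eq_norm]
      refine (hK.dist_le_mul z (hb₁ hz.1) q (hb₁ (hs q hq).1)).trans ?_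
      gcongr; exact hz.2
    · exact ⟨(hs q hq).1, by simp⟩
    · exact ⟨(hs y hy).1, by simp⟩
  rw [hq0, sub_zero, hcv, ← dist_eq_norm y q, mul_assoc, ← sq, Real.norm_eq_abs, abs_le] at taylor
  have hρ : |ρ y| ≤ K * dist y q ^ 2 := by
    rw [h.mem_iff y hyδ] at hne
    have hT : y ∈ halfSpace q μ ↔ 0 < ⟪μ, y - q⟫ := Iff.rfl
    rw [hT] at hne
    rw [abs_le]
    rcases lt_or_ge 0 (ρ y) with h0 | h0
    · have : ⟪μ, y - q⟫ ≤ 0 := not_lt.1 fun h3 => hne ⟨fun _ => h0, fun _ => h3⟩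
      constructor
      · nlinarith [K.2, sq_nonneg (dist y q), mul_nonneg K.2 (sq_nonneg (dist y q))]
      · nlinarith
    · have : 0 < ⟪μ, y - q⟫ := by
        by_contra h3; exact hne ⟨fun h4 => absurd h4 h3, fun h4 => absurd h4 (not_lt.2 h0)⟩
      constructor
      · nlinarith
      · nlinarith [K.2, sq_nonneg (dist y q), mul_nonneg K.2 (sq_nonneg (dist y q))]
  have hz : y + (-ρ y) • ν ∈ frontier Ω := by
    refine h.mem_frontier_of_eq_zero hΩ ?_ (by rw [h.add_smul]; ring)
    have h5 := hb₂ y (hs y hy).2.1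
    rw [mem_ball]
    calc dist (y + (-ρ y) • ν) p ≤ dist (y + (-ρ y) • ν) y + dist y p := dist_triangle _ _ _
      _ = |ρ y| + dist y p := by
        rw [dist_eq_norm, add_sub_cancel_left, norm_smul, h.norm_eq, norm_neg, mul_one,
          Real.norm_eq_abs]
      _ < δ := by linarith [(hs y hy).2.2]
  calc infDist y (frontier Ω) ≤ dist y (y + (-ρ y) • ν) := infDist_le_dist_of_mem hz
    _ = |ρ y| := by
      rw [dist_comm, dist_eq_norm, add_sub_cancel_left, norm_smul, h.norm_eq, norm_neg, mul_one,
          Real.norm_eq_abs]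
    _ ≤ _ := hρ

end IsLocalDefining

/-- Points on which `Ω` and the half-space tangent to it at `q` disagree lie quadratically close
to `∂Ω`, uniformly in `q`. -/
lemma exists_infDist_frontier_le_sq {n : ℕ} {Ω : Set (Euc n)} (hΩ : IsOpen Ω)
    (hb : Bornology.IsBounded Ω) (hC2 : HasC2Boundary Ω) :
    ∃ C ≥ (1 : ℝ), ∀ q ∈ frontier Ω, ∀ μ, IsInnerUnitNormal Ω q μ →
      ∀ y, ¬ (y ∈ halfSpace q μ ↔ y ∈ Ω) → infDist y (frontier Ω) ≤ C * dist y q ^ 2 := by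
  have hcpt : IsCompact (frontier Ω) :=
    Metric.isCompact_of_isClosed_isBounded isClosed_frontier
      (hb.closure.subset frontier_subset_closure)
  suffices H : ∃ C ≥ (1 : ℝ), ∀ q ∈ frontier Ω, q ∈ frontier Ω → ∀ μ, IsInnerUnitNormal Ω q μ →
      ∀ y, ¬ (y ∈ halfSpace q μ ↔ y ∈ Ω) → infDist y (frontier Ω) ≤ C * dist y q ^ 2 by
    obtain ⟨C, hC, H⟩ := H
    exact ⟨C, hC, fun q hq => H q hq hq⟩
  refine hcpt.induction_on (p := fun s => ∃ C ≥ (1 : ℝ), ∀ q ∈ s, q ∈ frontier Ω → ∀ μ,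
    IsInnerUnitNormal Ω q μ → ∀ y, ¬ (y ∈ halfSpace q μ ↔ y ∈ Ω) →
      infDist y (frontier Ω) ≤ C * dist y q ^ 2) ⟨1, le_rfl, by simp⟩ ?_ ?_ ?_
  · rintro s t hst ⟨C, hC, H⟩
    exact ⟨C, hC, fun q hq => H q (hst hq)⟩
  · rintro s t ⟨C, hC, H⟩ ⟨C', hC', H'⟩
    refine ⟨max C C', hC.trans (le_max_left _ _), fun q hq hqf μ hμ y hy => ?_⟩
    rcases hq with hq | hq
    · exact (H q hq hqf μ hμ y hy).trans (by gcongr; exact le_max_left _ _)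
    · exact (H' q hq hqf μ hμ y hy).trans (by gcongr; exact le_max_right _ _)
  · intro p hp
    obtain ⟨ν, hν⟩ := hC2 p hp
    obtain ⟨ρ, δ, h⟩ := hν.exists_isLocalDefining
    obtain ⟨ε, hε, C, H⟩ := h.exists_infDist_le_sq hΩ
    refine ⟨ball p (ε / 2), mem_nhdsWithin_of_mem_nhds (ball_mem_nhds p (by positivity)),
      max 1 (max C (ε / 2)⁻¹), le_max_left _ _, fun q hq hqf μ hμ y hy => ?_⟩
    rcases lt_or_ge (dist y q) (ε / 2) with h1 | h1
    · refine (H q (ball_subset_ball (by linarith) hq) hqf μ hμ y ?_ hy).trans ?_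
      · rw [mem_ball] at hq ⊢
        linarith [dist_triangle y q p]
      · gcongr
        exact (le_max_left _ _).trans (le_max_right _ _)
    · calc infDist y (frontier Ω) ≤ dist y q := infDist_le_dist_of_mem hqf
        _ = (ε / 2)⁻¹ * (ε / 2 * dist y q) := by field_simp
        _ ≤ (ε / 2)⁻¹ * (dist y q * dist y q) := by gcongr
        _ ≤ _ := by
          rw [← sq]
          gcongr
          exact (le_max_right _ _).trans (le_max_right _ _)

/-- A slab `|ρ| ≤ τ` transversal to `ν` has many disjoint translates along `ν`, hence
occupies a small part of each ball. -/
lemma volume_slab_inter_ball_le {n : ℕ} (hn : 1 ≤ n) {ν : Euc n} (hν : ‖ν‖ = 1) {ρ : Euc n → ℝ}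
    (hρ : Continuous ρ) (hadd : ∀ y (t : ℝ), ρ (y + t • ν) = ρ y + t) {τ r : ℝ} (hτ : 0 < τ)
    (hr : 0 < r) (x : Euc n) :
    volume ({y | |ρ y| ≤ τ} ∩ ball x r) ≤
      ENNReal.ofReal (τ * r ^ (n - 1)) *
        (ENNReal.ofReal (4 ^ n) * volume (ball (0 : Euc n) 1)) := by
  set S : Set (Euc n) := {y | |ρ y| ≤ τ} ∩ ball x r with hS
  have hSm : MeasurableSet S :=
    (isClosed_le hρ.abs continuous_const).measurableSet.inter measurableSet_ball
  -- `m + 1 ≥ r / τ` translates by multiples of `3τ`, all within a distance `3r`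
  set m : ℕ := ⌊r / τ⌋₊
  let T : ℕ → Set (Euc n) := fun k => (fun y => y + (-(3 * τ * k)) • ν) ⁻¹' S
  have hTm : ∀ k, MeasurableSet (T k) := fun k => hSm.preimage (by fun_prop)
  have hTv : ∀ k, volume (T k) = volume S := fun k => measure_preimage_add_right _ _ _
  have hdisj : Pairwise (Function.onFun Disjoint T) := by
    intro i j hij
    refine Set.disjoint_left.2 fun y hi hj => hij ?_
    have h1 : |ρ (y + (-(3 * τ * i)) • ν)| ≤ τ := hi.1
    have h2 : |ρ (y + (-(3 * τ * j)) • ν)| ≤ τ := hj.1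
    rw [hadd, abs_le] at h1 h2
    have h3 : (i : ℝ) < j + 1 := by nlinarith
    have h4 : (j : ℝ) < i + 1 := by nlinarith
    norm_cast at h3 h4
    omega
  have hsub : (⋃ k ∈ Finset.range (m + 1), T k) ⊆ ball x (4 * r) := by
    intro y hy
    obtain ⟨k, hk, hyk⟩ := mem_iUnion₂.1 hy
    have h1 : dist (y + (-(3 * τ * k)) • ν) x < r := hyk.2
    have hk' : (k : ℝ) ≤ r / τ :=
      (Nat.cast_le.2 (Nat.lt_succ_iff.1 (Finset.mem_range.1 hk))).trans
        (Nat.floor_le (by positivity))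
    rw [le_div_iff₀ hτ] at hk'
    have h2 : dist y (y + (-(3 * τ * k)) • ν) = 3 * τ * k := by
      rw [dist_comm, dist_eq_norm, add_sub_cancel_left, norm_smul, hν, norm_neg, mul_one,
        Real.norm_eq_abs, abs_of_nonneg (by positivity)]
    rw [mem_ball]
    nlinarith [dist_triangle y (y + (-(3 * τ * k)) • ν) x]
  have hcount : ((m + 1 : ℕ) : ℝ≥0∞) * volume S ≤
      ENNReal.ofReal ((4 * r) ^ n) * volume (ball (0 : Euc n) 1) := by
    calc ((m + 1 : ℕ) : ℝ≥0∞) * volume S = ∑ k ∈ Finset.range (m + 1), volume (T k) := by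
          simp [hTv]
      _ = volume (⋃ k ∈ Finset.range (m + 1), T k) :=
          (measure_biUnion_finset (fun i _ j _ hij => hdisj hij) fun k _ => hTm k).symm
      _ ≤ volume (ball x (4 * r)) := measure_mono hsub
      _ = _ := by
          rw [Measure.addHaar_ball_of_pos _ _ (by positivity), finrank_euclideanSpace_fin]
  have hm : ENNReal.ofReal (r / τ) ≤ ((m + 1 : ℕ) : ℝ≥0∞) := by
    rw [← ENNReal.ofReal_natCast]
    exact ENNReal.ofReal_le_ofReal (by push_cast; exact (Nat.lt_floor_add_one _).le)
  have hone : ENNReal.ofReal (τ / r) * ENNReal.ofReal (r / τ) = 1 := by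
    rw [← ENNReal.ofReal_mul (by positivity)]
    simp [show τ / r * (r / τ) = 1 by field_simp]
  calc volume S = ENNReal.ofReal (τ / r) * (ENNReal.ofReal (r / τ) * volume S) := by
        rw [← mul_assoc, hone, one_mul]
    _ ≤ ENNReal.ofReal (τ / r) *
        (ENNReal.ofReal ((4 * r) ^ n) * volume (ball (0 : Euc n) 1)) := by
        exact mul_le_mul_right ((mul_le_mul_left hm _).trans hcount) _
    _ = _ := by
        rw [← mul_assoc, ← mul_assoc, ← ENNReal.ofReal_mul (by positivity),
          ← ENNReal.ofReal_mul (by positivity)]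
        congr 2
        obtain ⟨k, rfl⟩ : ∃ k, n = k + 1 := ⟨n - 1, by omega⟩
        rw [Nat.add_sub_cancel, mul_pow]
        field_simp
        ring

/-- The layer estimate for thin layers, from the slabs `|ρ| ≤ K t` of finitely many local defining
functions `ρ` with Lipschitz constant `K`. -/
lemma exists_volume_thickening_inter_ball_le_of_le {n : ℕ} (hn : 1 ≤ n) {Ω : Set (Euc n)}
    (hΩ : IsOpen Ω) (hb : Bornology.IsBounded Ω) (hC2 : HasC2Boundary Ω) :
    ∃ t₀ > (0 : ℝ), ∃ C : ℝ≥0, ∀ t > 0, t ≤ t₀ → ∀ x, ∀ r > 0,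
      volume ({y | ∃ q ∈ frontier Ω, dist y q ≤ t} ∩ ball x r) ≤
        C * ENNReal.ofReal (t * r ^ (n - 1)) := by
  have hcpt : IsCompact (frontier Ω) :=
    Metric.isCompact_of_isClosed_isBounded isClosed_frontier
      (hb.closure.subset frontier_subset_closure)
  -- the induction runs over arbitrary sets `s` meeting `∂Ω`, not only over its subsets
  suffices H : ∃ t₀ > (0 : ℝ), ∃ C : ℝ≥0, ∀ t > 0, t ≤ t₀ → ∀ x, ∀ r > 0,
      volume ({y | ∃ q ∈ frontier Ω, q ∈ frontier Ω ∧ dist y q ≤ t} ∩ ball x r) ≤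
        C * ENNReal.ofReal (t * r ^ (n - 1)) by
    obtain ⟨t₀, ht₀, C, H⟩ := H
    refine ⟨t₀, ht₀, C, fun t ht htt x r hr => (measure_mono ?_).trans (H t ht htt x r hr)⟩
    refine inter_subset_inter_left _ ?_
    rintro y ⟨q, hq, h⟩
    exact ⟨q, hq, hq, h⟩
  refine hcpt.induction_on (p := fun s => ∃ t₀ > (0 : ℝ), ∃ C : ℝ≥0, ∀ t > 0, t ≤ t₀ →
    ∀ x, ∀ r > 0, volume ({y | ∃ q ∈ s, q ∈ frontier Ω ∧ dist y q ≤ t} ∩ ball x r) ≤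
        C * ENNReal.ofReal (t * r ^ (n - 1))) ⟨1, one_pos, 0, by simp⟩ ?_ ?_ ?_
  · rintro s s' hst ⟨t₀, ht₀, C, H⟩
    refine ⟨t₀, ht₀, C, fun t ht htt x r hr => (measure_mono ?_).trans (H t ht htt x r hr)⟩
    refine inter_subset_inter_left _ ?_
    rintro y ⟨q, hq, h⟩
    exact ⟨q, hst hq, h⟩
  · rintro s s' ⟨t₀, ht₀, C, H⟩ ⟨t₀', ht₀', C', H'⟩
    refine ⟨min t₀ t₀', lt_min ht₀ ht₀', C + C', fun t ht htt x r hr => ?_⟩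
    rw [ENNReal.coe_add, add_mul]
    refine le_trans (le_trans (measure_mono ?_) (measure_union_le _ _)) (add_le_add
      (H t ht (htt.trans (min_le_left _ _)) x r hr)
      (H' t ht (htt.trans (min_le_right _ _)) x r hr))
    rintro y ⟨⟨q, hq | hq, h⟩, hy⟩
    · exact Or.inl ⟨⟨q, hq, h⟩, hy⟩
    · exact Or.inr ⟨⟨q, hq, h⟩, hy⟩
  · intro p hp
    obtain ⟨ν, hν⟩ := hC2 p hp
    obtain ⟨ρ, δ, h⟩ := hν.exists_isLocalDefining
    obtain ⟨K, s, hs, hK⟩ : ∃ K, ∃ s ∈ 𝓝 p, LipschitzOnWith K ρ s :=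
      ContDiffAt.exists_lipschitzOnWith (h.contDiff.of_le (by norm_num)).contDiffAt
    obtain ⟨ε, hε, hbs⟩ := Metric.mem_nhds_iff.1 (Filter.inter_mem hs (ball_mem_nhds p h.pos))
    refine ⟨ball p (ε / 2), mem_nhdsWithin_of_mem_nhds (ball_mem_nhds p (by positivity)),
      ε / 2, by positivity, (K + 1) * (4 ^ n * (volume (ball (0 : Euc n) 1)).toNNReal),
      fun t ht htt x r hr => ?_⟩
    have hK1 : 0 < ((K : ℝ) + 1) * t := by positivity
    refine le_trans (measure_mono (inter_subset_inter_left _ ?_))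
      ((volume_slab_inter_ball_le hn h.norm_eq h.contDiff.continuous h.add_smul hK1 hr x).trans
        (le_of_eq ?_))
    · rintro y ⟨q, hq, hqf, hyq⟩
      rw [mem_ball] at hq
      have hq' := hbs (show q ∈ ball p ε by rw [mem_ball]; linarith)
      have hy' := hbs (show y ∈ ball p ε by rw [mem_ball]; linarith [dist_triangle y q p])
      have h1 := hK.dist_le_mul y hy'.1 q hq'.1
      rw [h.eq_zero_of_mem_frontier hΩ hq'.2 hqf, Real.dist_eq, sub_zero] at h1
      have h2 : (K : ℝ) * dist y q ≤ K * t := by gcongr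
      show |ρ y| ≤ _
      nlinarith
    · rw [mul_assoc ((K : ℝ) + 1), ENNReal.ofReal_mul (by positivity)]
      push_cast
      rw [ENNReal.coe_toNNReal measure_ball_lt_top.ne,
        show ENNReal.ofReal ((K : ℝ) + 1) = (K : ℝ≥0∞) + 1 by
          rw [ENNReal.ofReal_add K.coe_nonneg zero_le_one, ENNReal.ofReal_coe_nnreal,
            ENNReal.ofReal_one],
        ENNReal.ofReal_pow (by norm_num), ENNReal.ofReal_ofNat]
      ring

/-- Within a ball of radius `r`, the layer of width `t` around `∂Ω` has volume `O(t rⁿ⁻¹)`,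
whatever the sizes of `t` and `r`. -/
lemma exists_volume_layer_inter_ball_le {n : ℕ} (hn : 1 ≤ n) {Ω : Set (Euc n)}
    (hΩ : IsOpen Ω) (hb : Bornology.IsBounded Ω) (hC2 : HasC2Boundary Ω)
    (hne : (frontier Ω).Nonempty) :
    ∃ C : ℝ≥0, ∀ t > 0, ∀ x, ∀ r > 0,
      volume ({y | infDist y (frontier Ω) ≤ t} ∩ ball x r) ≤
        C * ENNReal.ofReal (t * r ^ (n - 1)) := by
  have hcpt : IsCompact (frontier Ω) :=
    Metric.isCompact_of_isClosed_isBounded isClosed_frontier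
      (hb.closure.subset frontier_subset_closure)
  obtain ⟨R, hR, hRb⟩ := hcpt.isBounded.subset_ball_lt 0 (0 : Euc n)
  obtain ⟨t₀, ht₀, C, H⟩ := exists_volume_thickening_inter_ball_le_of_le hn hΩ hb hC2
  obtain ⟨k, rfl⟩ : ∃ k, n = k + 1 := ⟨n - 1, by omega⟩
  set v := volume (ball (0 : Euc (k + 1)) 1)
  have hv : v ≠ ⊤ := measure_ball_lt_top.ne
  have hball : ∀ (x : Euc (k + 1)) (s : ℝ), 0 < s → volume (ball x s) =
      ENNReal.ofReal (s ^ (k + 1)) * v := by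
    intro x s hs
    rw [Measure.addHaar_ball_of_pos _ _ hs, finrank_euclideanSpace_fin]
  set A : ℝ := (R / t₀ + 2) ^ (k + 1) with hA
  have hA1 : 1 ≤ A := one_le_pow₀ (by have : 0 < R / t₀ := by positivity
                                      linarith)
  refine ⟨C + A.toNNReal * v.toNNReal, fun t ht x r hr => ?_⟩
  rw [ENNReal.coe_add, add_mul, ENNReal.coe_mul, ENNReal.coe_toNNReal hv]
  rw [Nat.add_sub_cancel] at H ⊢
  rcases le_or_gt t t₀ with htt | htt
  · refine le_trans (measure_mono (inter_subset_inter_left _ ?_))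
      ((H t ht htt x r hr).trans le_self_add)
    intro y hy
    obtain ⟨q, hq, hqd⟩ := hcpt.exists_infDist_eq_dist hne y
    exact ⟨q, hq, hqd ▸ hy⟩
  · refine le_trans ?_ le_add_self
    have hfin : ∀ s : ℝ, 0 ≤ s → s ≤ A * (t * r ^ k) →
        ENNReal.ofReal s * v ≤ A.toNNReal * v * ENNReal.ofReal (t * r ^ k) := by
      intro s hs hsA
      rw [mul_right_comm]
      gcongr
      rw [show (A.toNNReal : ℝ≥0∞) = ENNReal.ofReal A from rfl,
        ← ENNReal.ofReal_mul (by positivity)]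
      exact ENNReal.ofReal_le_ofReal hsA
    rcases le_or_gt r t with hrt | hrt
    · refine (measure_mono inter_subset_right).trans ?_
      rw [hball x r hr]
      refine hfin _ (by positivity) ?_
      calc r ^ (k + 1) = 1 * (r * r ^ k) := by ring
        _ ≤ A * (t * r ^ k) := by gcongr
    · refine (measure_mono (t := ball (0 : Euc (k + 1)) (R + 2 * t)) ?_).trans ?_
      · rintro y ⟨hy, -⟩
        obtain ⟨q, hq, hqd⟩ := hcpt.exists_infDist_eq_dist hne y
        have h1 : dist y q ≤ t := hqd ▸ hy
        have h2 := hRb hq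
        rw [mem_ball] at h2 ⊢
        linarith [dist_triangle y q 0]
      · rw [hball _ _ (by positivity)]
        refine hfin _ (by positivity) ?_
        have h1 : R + 2 * t ≤ (R / t₀ + 2) * t := by
          have : R ≤ R / t₀ * t := by
            rw [div_mul_eq_mul_div, le_div_iff₀ ht₀]; gcongr
          linarith
        calc (R + 2 * t) ^ (k + 1) ≤ ((R / t₀ + 2) * t) ^ (k + 1) := by gcongr
          _ = A * (t * t ^ k) := by rw [mul_pow, hA, pow_succ t]; ring
          _ ≤ A * (t * r ^ k) := by gcongr

/-! ### Riemann sums over scaled lattices -/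

/-- The integer part of a vector, coordinatewise. -/
noncomputable def floorVec {n : ℕ} (w : Euc n) : Fin n → ℤ := fun i => ⌊w i⌋

lemma measurePreserving_floorVec (n : ℕ) :
    MeasurePreserving (floorVec (n := n)) volume Measure.count := by
  have hm : Measurable (floorVec (n := n)) :=
    measurable_pi_lambda _ fun i => Int.measurable_floor.comp (by fun_prop)
  refine ⟨hm, Measure.ext_of_singleton fun m => ?_⟩
  rw [Measure.map_apply hm (measurableSet_singleton m), Measure.count_singleton,
    ← (PiLp.volume_preserving_toLp (Fin n)).measure_preimage
      (hm (measurableSet_singleton m)).nullMeasurableSet]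
  have : WithLp.toLp 2 ⁻¹' (floorVec ⁻¹' {m}) =
      univ.pi fun i => Ico (m i : ℝ) (m i + 1) := by
    ext w
    simp [floorVec, funext_iff, Int.floor_eq_iff]
  rw [this, Real.volume_pi_Ico]
  simp

lemma norm_sub_gridPoint_floorVec_le {n : ℕ} (w : Euc n) :
    ‖w - gridPoint 1 (floorVec w)‖ ≤ √n := by
  rw [EuclideanSpace.norm_eq]
  refine Real.sqrt_le_sqrt ?_
  calc ∑ i, ‖(w - gridPoint 1 (floorVec w)) i‖ ^ 2 ≤ ∑ _i : Fin n, (1 : ℝ) := by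
        refine Finset.sum_le_sum fun i _ => ?_
        have : (w - gridPoint 1 (floorVec w)) i = Int.fract (w i) := by
          simp [gridPoint, floorVec]
        rw [this, Real.norm_eq_abs, abs_of_nonneg (Int.fract_nonneg _)]
        exact pow_le_one₀ (Int.fract_nonneg _) (Int.fract_lt_one _).le
    _ = n := by simp

lemma one_add_norm_le_of_norm_sub_le {E : Type*} [NormedAddCommGroup E] {u z : E} {c : ℝ}
    (h : ‖u - z‖ ≤ c) : 1 + ‖z‖ ≤ (1 + c) * (1 + ‖u‖) := by
  have h1 : ‖z‖ ≤ ‖u‖ + c := by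
    have := norm_sub_norm_le z u
    rw [norm_sub_rev] at this
    linarith
  nlinarith [norm_nonneg u, (norm_nonneg _).trans h,
    mul_nonneg ((norm_nonneg _).trans h) (norm_nonneg u)]

lemma inv_pow_one_add_norm_le_of_norm_sub_le {E : Type*} [NormedAddCommGroup E] {u z : E} {c : ℝ}
    (h : ‖u - z‖ ≤ c) (k : ℕ) :
    ((1 + ‖u‖) ^ k)⁻¹ ≤ (1 + c) ^ k * ((1 + ‖z‖) ^ k)⁻¹ := by
  have hc : 0 ≤ c := (norm_nonneg _).trans h
  rw [inv_le_iff_one_le_mul₀ (by positivity), mul_right_comm, ← mul_pow,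
    ← div_eq_mul_inv, le_div_iff₀ (by positivity), one_mul]
  exact pow_le_pow_left₀ (by positivity) (one_add_norm_le_of_norm_sub_le h) k

lemma integrable_inv_pow_one_add_norm (n : ℕ) :
    Integrable (fun z : Euc n => ((1 + ‖z‖) ^ (n + 1))⁻¹) := by
  have := integrable_one_add_norm (E := Euc n) (μ := volume) (r := (n + 1 : ℕ))
    (by rw [finrank_euclideanSpace_fin]; norm_num)
  refine this.congr (Eventually.of_forall fun z => ?_)
  simp only
  rw [Real.rpow_neg (by positivity), Real.rpow_natCast]

section Lattice
variable {n : ℕ} {τ : ℝ}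

lemma integral_comp_smul_sub {F : Type*} [NormedAddCommGroup F] [NormedSpace ℝ F]
    (hτ : 0 < τ) (g : Euc n → F) (t : Euc n) :
    τ ^ n • ∫ w, g (τ • (t - w)) = ∫ z, g z := by
  rw [integral_sub_left_eq_self (fun z => g (τ • z)) volume t, Measure.integral_comp_smul,
    finrank_euclideanSpace_fin, abs_of_pos (by positivity), smul_smul,
    mul_inv_cancel₀ (by positivity), one_smul]

lemma integrable_comp_smul_sub {F : Type*} [NormedAddCommGroup F] [NormedSpace ℝ F]
    (hτ : 0 < τ) {g : Euc n → F} (hg : Integrable g) (t : Euc n) :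
    Integrable fun w => g (τ • (t - w)) :=
  (hg.comp_smul hτ.ne').comp_sub_left t

/-- A point and the node of its cell, both rescaled by `τ`, are at distance at most `√n τ`. -/
lemma norm_smul_sub_floorVec_le (hτ : 0 < τ) (t w : Euc n) :
    ‖τ • (t - gridPoint 1 (floorVec w)) - τ • (t - w)‖ ≤ √n * τ := by
  rw [← smul_sub, sub_sub_sub_cancel_left, norm_smul, Real.norm_of_nonneg hτ.le, mul_comm]
  gcongr
  exact norm_sub_gridPoint_floorVec_le w

lemma integrable_inv_pow_floorVec (hτ : 0 < τ) (hτ1 : τ ≤ 1) (t : Euc n) :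
    Integrable fun w : Euc n =>
      ((1 + ‖τ • (t - gridPoint 1 (floorVec w))‖) ^ (n + 1))⁻¹ := by
  refine ((integrable_comp_smul_sub hτ (integrable_inv_pow_one_add_norm n) t).const_mul
    ((1 + √n) ^ (n + 1))).mono' ?_ (Eventually.of_forall fun w => ?_)
  · exact ((measurable_of_countable (fun m : Fin n → ℤ =>
      ((1 + ‖τ • (t - gridPoint 1 m)‖) ^ (n + 1))⁻¹)).comp
        (measurePreserving_floorVec n).measurable).aestronglyMeasurable
  · rw [Real.norm_of_nonneg (by positivity)]
    refine inv_pow_one_add_norm_le_of_norm_sub_le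
      ((norm_smul_sub_floorVec_le hτ t w).trans ?_) _
    exact mul_le_of_le_one_right (by positivity) hτ1

/-- Lattice sums of `m ↦ g m` are integrals of the step function `g ∘ floorVec`. -/
lemma hasSum_integral_floorVec {g : (Fin n → ℤ) → ℂ} (hg : Integrable fun w => g (floorVec w)) :
    Summable g ∧ ∑' m, g m = ∫ w, g (floorVec w) := by
  have hmp := measurePreserving_floorVec n
  have hgs : AEStronglyMeasurable g (Measure.map (floorVec (n := n)) volume) :=
    (measurable_of_countable g).aestronglyMeasurable
  have hg' : Integrable g Measure.count := by
    rw [← hmp.map_eq, integrable_map_measure hgs hmp.aemeasurable]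
    exact hg
  refine ⟨(integrable_count_iff.1 hg').of_norm, ?_⟩
  rw [← integral_map hmp.aemeasurable hgs, hmp.map_eq, integral_countable hg']
  simp

/-- The rescaled lattice sums of an integrable power weight are bounded. -/
lemma exists_tsum_inv_pow_le (n : ℕ) : ∃ C > (0 : ℝ), ∀ τ : ℝ, 0 < τ → τ ≤ 1 → ∀ t : Euc n,
    (Summable fun m => τ ^ n * ((1 + ‖τ • (t - gridPoint 1 m)‖) ^ (n + 1))⁻¹) ∧
      ∑' m, τ ^ n * ((1 + ‖τ • (t - gridPoint 1 m)‖) ^ (n + 1))⁻¹ ≤ C := by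
  have hI0 : 0 ≤ ∫ z : Euc n, ((1 + ‖z‖) ^ (n + 1))⁻¹ := by positivity
  refine ⟨1 + (1 + √n) ^ (n + 1) * ∫ z : Euc n, ((1 + ‖z‖) ^ (n + 1))⁻¹, by positivity,
    fun τ hτ hτ1 t => ?_⟩
  have hi := integrable_inv_pow_floorVec hτ hτ1 t
  obtain ⟨h1, h2⟩ := hasSum_integral_floorVec (g := fun m =>
    ((((1 + ‖τ • (t - gridPoint 1 m)‖) ^ (n + 1))⁻¹ : ℝ) : ℂ)) hi.ofReal
  have h1' := Complex.summable_ofReal.1 h1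
  rw [integral_complex_ofReal, ← Complex.ofReal_tsum, Complex.ofReal_inj] at h2
  refine ⟨h1'.mul_left _, ?_⟩
  rw [tsum_mul_left, h2, ← integral_comp_smul_sub hτ (fun z : Euc n => ((1 + ‖z‖) ^ (n + 1))⁻¹) t,
    smul_eq_mul]
  have h3 := integral_mono hi ((integrable_comp_smul_sub hτ
    (integrable_inv_pow_one_add_norm n) t).const_mul ((1 + √n) ^ (n + 1))) fun w =>
      inv_pow_one_add_norm_le_of_norm_sub_le
        ((norm_smul_sub_floorVec_le hτ t w).trans (mul_le_of_le_one_right (by positivity) hτ1)) _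
  rw [integral_const_mul] at h3
  have h4 := mul_le_mul_of_nonneg_left h3 (pow_nonneg hτ.le n)
  linarith

lemma SchwartzMap.exists_norm_le_inv_pow {n : ℕ} (g : 𝓢(Euc n, ℂ)) (k j : ℕ) :
    ∃ A > (0 : ℝ), ∀ z, ‖iteratedFDeriv ℝ j g z‖ ≤ A * ((1 + ‖z‖) ^ k)⁻¹ := by
  refine ⟨2 ^ k * ((Finset.Iic (k, j)).sup (fun m => SchwartzMap.seminorm ℝ m.1 m.2)) g + 1,
    by positivity, fun z => ?_⟩
  have := g.one_add_le_sup_seminorm_apply (𝕜 := ℝ) (m := (k, j)) (k := k) (n := j) le_rfl le_rfl z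
  rw [← div_eq_mul_inv, le_div_iff₀ (by positivity), mul_comm]
  exact this.trans (by simp)

/-- Riemann sums of a Schwartz function converge to its integral, uniformly in the position of
the lattice. -/
lemma SchwartzMap.exists_norm_tsum_sub_integral_le {n : ℕ} (g : 𝓢(Euc n, ℂ)) :
    ∃ C > (0 : ℝ), ∀ τ : ℝ, 0 < τ → τ ≤ 1 → ∀ t : Euc n,
      (Summable fun m => (τ ^ n : ℝ) • g (τ • (t - gridPoint 1 m))) ∧
      ‖∑' m, (τ ^ n : ℝ) • g (τ • (t - gridPoint 1 m)) - ∫ z, g z‖ ≤ C * τ := by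
  obtain ⟨A, hA, hgA⟩ := g.exists_norm_le_inv_pow (n + 1) 0
  obtain ⟨A', hA', hgA'⟩ := g.exists_norm_le_inv_pow (n + 1) 1
  simp only [norm_iteratedFDeriv_zero, norm_iteratedFDeriv_one] at hgA hgA'
  have hI0 : 0 ≤ ∫ z : Euc n, ((1 + ‖z‖) ^ (n + 1))⁻¹ := by positivity
  set I := ∫ z : Euc n, ((1 + ‖z‖) ^ (n + 1))⁻¹
  refine ⟨1 + A' * (1 + √n) ^ (n + 1) * √n * I, by positivity, fun τ hτ hτ1 t => ?_⟩
  have hi : Integrable fun w => g (τ • (t - gridPoint 1 (floorVec w))) := by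
    refine ((integrable_inv_pow_floorVec hτ hτ1 t).const_mul A).mono' ?_
      (Eventually.of_forall fun w => hgA _)
    exact ((measurable_of_countable (fun m : Fin n → ℤ => g (τ • (t - gridPoint 1 m)))).comp
        (measurePreserving_floorVec n).measurable).aestronglyMeasurable
  obtain ⟨h1, h2⟩ := hasSum_integral_floorVec (g := fun m => g (τ • (t - gridPoint 1 m))) hi
  refine ⟨h1.const_smul _, ?_⟩
  have hi' := integrable_comp_smul_sub hτ g.integrable t
  rw [tsum_const_smul'', h2, ← integral_comp_smul_sub hτ g t, ← smul_sub, ← integral_sub hi hi',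
    norm_smul, Real.norm_of_nonneg (by positivity)]
  have hpt : ∀ w, ‖g (τ • (t - gridPoint 1 (floorVec w))) - g (τ • (t - w))‖ ≤
      A' * (1 + √n) ^ (n + 1) * (√n * τ) * ((1 + ‖τ • (t - w)‖) ^ (n + 1))⁻¹ := by
    intro w
    have hd := norm_smul_sub_floorVec_le hτ t w
    set u := τ • (t - gridPoint 1 (floorVec w))
    set z := τ • (t - w)
    have := Convex.norm_image_sub_le_of_norm_fderiv_le (𝕜 := ℝ) (f := g)
      (s := closedBall z (√n * τ))
      (C := A' * ((1 + √n) ^ (n + 1) * ((1 + ‖z‖) ^ (n + 1))⁻¹)) (x := z) (y := u)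
      (fun _ _ => g.differentiableAt) (fun ξ hξ => (hgA' ξ).trans (by
        gcongr
        refine inv_pow_one_add_norm_le_of_norm_sub_le ?_ _
        rw [← dist_eq_norm]
        exact hξ.trans (mul_le_of_le_one_right (by positivity) hτ1)))
      (convex_closedBall _ _) (by simp; positivity) (by rw [mem_closedBall, dist_eq_norm]; exact hd)
    refine this.trans ?_
    calc _ ≤ A' * ((1 + √n) ^ (n + 1) * ((1 + ‖z‖) ^ (n + 1))⁻¹) * (√n * τ) := by gcongr
      _ = _ := by ring
  have h3 := norm_integral_le_of_norm_le ((integrable_comp_smul_sub hτ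
    (integrable_inv_pow_one_add_norm n) t).const_mul (A' * (1 + √n) ^ (n + 1) * (√n * τ)))
    (Eventually.of_forall hpt)
  rw [integral_const_mul] at h3
  have h4 := mul_le_mul_of_nonneg_left h3 (pow_nonneg hτ.le n)
  have h5 := integral_comp_smul_sub hτ (fun z : Euc n => ((1 + ‖z‖) ^ (n + 1))⁻¹) t
  rw [smul_eq_mul] at h5
  refine h4.trans ?_
  calc _ = A' * (1 + √n) ^ (n + 1) * (√n * τ) *
        (τ ^ n * ∫ w, ((1 + ‖τ • (t - w)‖) ^ (n + 1))⁻¹) := by ring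
    _ = A' * (1 + √n) ^ (n + 1) * √n * I * τ := by rw [h5]; ring
    _ ≤ _ := by gcongr; linarith

end Lattice

/-! ### Singularity and growth of the fundamental solution -/

/-- The exponent of a power singularity dominating that of `fundSol`: `n - 3/2` for `n ≥ 2` and `0`
for `n = 1`. It exceeds the sharp exponent `n - 2`, which absorbs the logarithm for `n = 2`, but is
still less than `n - 1`, so that the singularity is integrable over hypersurfaces. -/
noncomputable def singExp (n : ℕ) : ℝ := max 0 ((n : ℝ) - 3 / 2)

lemma singExp_nonneg (n : ℕ) : 0 ≤ singExp n := le_max_left _ _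

lemma rpow_le_max_one_rpow_neg {t e q : ℝ} (ht : 0 < t) (he : e ≤ 0) (hq : -q ≤ e) :
    t ^ e ≤ max 1 (t ^ (-q)) := by
  rcases le_total t 1 with h | h
  · exact (Real.rpow_le_rpow_of_exponent_ge ht h hq).trans (le_max_right _ _)
  · exact (Real.rpow_le_one_of_one_le_of_nonpos h he).trans (le_max_left _ _)

/-- On the cut plane, `1 + v / lam` stays away from zero for `v ≥ 0`; this bounds negative powers
of it. -/
lemma exists_pos_le_norm_one_add_div {lam : ℂ} (hlam : lam ∈ Complex.slitPlane) :
    ∃ c > (0 : ℝ), ∀ v : ℝ, 0 ≤ v → c ≤ ‖1 + (v : ℂ) / lam‖ := by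
  have h0 : lam ≠ 0 := Complex.slitPlane_ne_zero hlam
  have hn : 0 < ‖lam‖ := norm_pos_iff.2 h0
  refine ⟨max lam.re |lam.im| / ‖lam‖, ?_, fun v hv => ?_⟩
  · refine div_pos ?_ hn
    rcases Complex.mem_slitPlane_iff.1 hlam with h | h
    · exact lt_max_of_lt_left h
    · exact lt_max_of_lt_right (abs_pos.2 h)
  · rw [show 1 + (v : ℂ) / lam = (lam + v) / lam by field_simp, norm_div]
    gcongr
    refine max_le ?_ ?_
    · have := Complex.re_le_norm (lam + v)
      simp at this
      linarith
    · have := Complex.abs_im_le_norm (lam + v)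
      simpa using this

/-- The Laplace-type integral defining `besselK` grows at most like a power at the origin. -/
lemma exists_norm_besselK_integral_le {lam : ℂ} (hlam : lam ∈ Complex.slitPlane) {μ : ℝ}
    (hμ : -1 < μ) : ∃ C > (0 : ℝ), ∀ t : ℝ, 0 < t →
      ‖∫ u in Ioi (0 : ℝ), ((Real.exp (-u) * u ^ μ : ℝ) : ℂ) *
        (1 + (u : ℂ) / (2 * (lam * (t : ℂ)))) ^ ((μ : ℝ) : ℂ)‖ ≤ C * (1 + t ^ (-max 0 μ)) := by
  have h0 : lam ≠ 0 := Complex.slitPlane_ne_zero hlam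
  have hn : 0 < ‖lam‖ := norm_pos_iff.2 h0
  have hG : ∀ s : ℝ, -1 < s → IntegrableOn (fun u => Real.exp (-u) * u ^ s) (Ioi 0) := by
    intro s hs
    have := Real.GammaIntegral_convergent (s := s + 1) (by linarith)
    simpa using this
  have hG0 : ∀ s : ℝ, 0 ≤ ∫ u in Ioi (0 : ℝ), Real.exp (-u) * u ^ s := fun s =>
    setIntegral_nonneg measurableSet_Ioi fun u (hu : 0 < u) => by positivity
  have hnorm : ∀ t : ℝ, 0 < t → ∀ u ∈ Ioi (0 : ℝ), ‖((Real.exp (-u) * u ^ μ : ℝ) : ℂ) *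
        (1 + (u : ℂ) / (2 * (lam * (t : ℂ)))) ^ ((μ : ℝ) : ℂ)‖ =
      Real.exp (-u) * u ^ μ * ‖1 + ((u / (2 * t) : ℝ) : ℂ) / lam‖ ^ μ := by
    intro t ht u hu
    have hu : 0 < u := hu
    have ht' : (t : ℂ) ≠ 0 := by exact_mod_cast ht.ne'
    rw [norm_mul, Complex.norm_cpow_real, Complex.norm_real, Real.norm_of_nonneg (by positivity)]
    congr 4
    push_cast
    field_simp
  rcases le_or_gt 0 μ with h | h
  · set I₁ := ∫ u in Ioi (0 : ℝ), Real.exp (-u) * u ^ μ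
    set I₂ := ∫ u in Ioi (0 : ℝ), Real.exp (-u) * u ^ (2 * μ)
    have hI₁ : 0 ≤ I₁ := hG0 _
    have hI₂ : 0 ≤ I₂ := hG0 _
    set k : ℝ := (2 * ‖lam‖) ^ (-μ)
    have hk : 0 ≤ k := by positivity
    refine ⟨2 ^ μ * (I₁ + k * I₂) + 1, by positivity, fun t ht => ?_⟩
    rw [max_eq_right h]
    have hb : ∀ u ∈ Ioi (0 : ℝ), ‖((Real.exp (-u) * u ^ μ : ℝ) : ℂ) *
        (1 + (u : ℂ) / (2 * (lam * (t : ℂ)))) ^ ((μ : ℝ) : ℂ)‖ ≤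
        2 ^ μ * (Real.exp (-u) * u ^ μ) +
          2 ^ μ * k * t ^ (-μ) * (Real.exp (-u) * u ^ (2 * μ)) := by
      intro u hu
      rw [hnorm t ht u hu]
      have hu : 0 < u := hu
      set x := u / (2 * ‖lam‖ * t) with hx
      have hx0 : 0 < x := by positivity
      have h1 : ‖1 + ((u / (2 * t) : ℝ) : ℂ) / lam‖ ≤ 1 + x := by
        refine (norm_add_le _ _).trans ?_
        rw [norm_one, norm_div, Complex.norm_real, Real.norm_of_nonneg (by positivity), div_div, hx,
          mul_right_comm]
      have h2 : (1 + x) ^ μ ≤ 2 ^ μ * (1 + x ^ μ) := by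
        rcases le_total x 1 with hx1 | hx1
        · calc (1 + x) ^ μ ≤ 2 ^ μ := by gcongr; linarith
            _ ≤ _ := le_mul_of_one_le_right (by positivity)
                (by linarith [Real.rpow_nonneg hx0.le μ])
        · calc (1 + x) ^ μ ≤ (2 * x) ^ μ := by gcongr; linarith
            _ = 2 ^ μ * x ^ μ := Real.mul_rpow (by norm_num) hx0.le
            _ ≤ _ := by gcongr; linarith
      have h3 : x ^ μ = k * t ^ (-μ) * u ^ μ := by
        rw [hx, Real.div_rpow hu.le (by positivity), Real.mul_rpow (by positivity) ht.le,
          div_eq_mul_inv, mul_inv, ← Real.rpow_neg (by positivity), ← Real.rpow_neg ht.le]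
        ring
      have h4 : u ^ (2 * μ) = u ^ μ * u ^ μ := by rw [two_mul, Real.rpow_add hu]
      calc _ ≤ Real.exp (-u) * u ^ μ * (2 ^ μ * (1 + x ^ μ)) := by
            gcongr
            exact (Real.rpow_le_rpow (norm_nonneg _) h1 h).trans h2
        _ = _ := by rw [h3, h4]; ring
    have h5 := norm_integral_le_of_norm_le
      (((hG μ hμ).const_mul (2 ^ μ)).add
        ((hG (2 * μ) (by linarith)).const_mul (2 ^ μ * k * t ^ (-μ))))
      (ae_restrict_of_forall_mem measurableSet_Ioi hb)
    refine h5.trans ?_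
    simp only [Pi.add_apply]
    rw [integral_add ((hG μ hμ).const_mul _) ((hG (2 * μ) (by linarith)).const_mul _),
      integral_const_mul, integral_const_mul]
    have h6 : 0 ≤ t ^ (-μ) := by positivity
    change 2 ^ μ * I₁ + 2 ^ μ * k * t ^ (-μ) * I₂ ≤ _
    have h7 : 0 ≤ (2 : ℝ) ^ μ := by positivity
    have h8 : 0 ≤ (2 : ℝ) ^ μ * I₁ := by positivity
    have h9 : 0 ≤ (2 : ℝ) ^ μ * k * I₂ := by positivity
    nlinarith [mul_nonneg h8 h6]
  · obtain ⟨c, hc, hcl⟩ := exists_pos_le_norm_one_add_div hlam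
    have hI := hG0 μ
    refine ⟨c ^ μ * (∫ u in Ioi (0 : ℝ), Real.exp (-u) * u ^ μ) + 1,
      add_pos_of_nonneg_of_pos (mul_nonneg (Real.rpow_nonneg hc.le μ) hI) one_pos, fun t ht => ?_⟩
    have h5 := norm_integral_le_of_norm_le ((hG μ hμ).const_mul (c ^ μ))
      (ae_restrict_of_forall_mem (μ := volume) measurableSet_Ioi fun u hu => by
        refine (hnorm t ht u hu).le.trans ?_
        have hu : 0 < u := hu
        rw [mul_comm]
        exact mul_le_mul_of_nonneg_right
          (Real.rpow_le_rpow_of_nonpos hc (hcl (u / (2 * t)) (by positivity)) h.le)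
          (by positivity))
    refine h5.trans ?_
    rw [integral_const_mul]
    have h6 : 0 ≤ t ^ (-max 0 μ) := by positivity
    have h7 : 0 ≤ c ^ μ := by positivity
    nlinarith [mul_nonneg h7 hI, mul_nonneg (mul_nonneg h7 hI) h6]

lemma fundSol_zero_of_ne_zero {n : ℕ} {lam : ℂ} (h : lam ≠ 0) : fundSol lam (0 : Euc n) = 0 := by
  simp [fundSol, h, besselK]

/-- Singularity and growth of the fundamental solution for `lam ≠ 0`. -/
lemma exists_norm_fundSol_le_exp {n : ℕ} (hn : 1 ≤ n) {lam : ℂ}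
    (hlam : lam ∈ Complex.slitPlane) : ∃ C > (0 : ℝ), ∀ z : Euc n,
      ‖fundSol lam z‖ ≤ C * max 1 (‖z‖ ^ (-singExp n)) * Real.exp (max 0 (-lam.re) * ‖z‖) := by
  have h0 : lam ≠ 0 := Complex.slitPlane_ne_zero hlam
  have hl : 0 < ‖lam‖ := norm_pos_iff.2 h0
  set ν : ℝ := (n : ℝ) / 2 - 1 with hν
  set μ : ℝ := |ν| - 1 / 2 with hμ
  obtain ⟨C, hC, hI⟩ := exists_norm_besselK_integral_le hlam (μ := μ)
    (by have := abs_nonneg ν; linarith)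
  have hΓ : 0 < Real.Gamma (|ν| + 1 / 2) := Real.Gamma_pos_of_pos (by positivity)
  set A : ℝ := 1 / (2 * Real.pi) ^ ((n : ℝ) / 2) * ‖lam‖ ^ (-(1 - (n : ℝ) / 2)) *
    ((Real.pi / (2 * ‖lam‖)) ^ (1 / 2 : ℝ) / Real.Gamma (|ν| + 1 / 2) * C) with hA
  have hA0 : 0 < A := by have := Real.pi_pos; positivity
  refine ⟨2 * A, by positivity, fun z => ?_⟩
  rcases eq_or_ne z 0 with rfl | hz
  · rw [fundSol_zero_of_ne_zero h0, norm_zero]; positivity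
  have ht : 0 < ‖z‖ := norm_pos_iff.2 hz
  set t := ‖z‖
  have hn' : (1 : ℝ) ≤ n := by exact_mod_cast hn
  have key : ‖fundSol lam z‖ ≤ A * Real.exp (-(lam.re * t)) *
      (t ^ (1 - (n : ℝ) / 2) * t ^ (-(1 / 2) : ℝ) * (1 + t ^ (-max 0 μ))) := by
    have e1 : ‖(((t : ℝ) : ℂ) / lam) ^ ((1 - (n : ℝ) / 2 : ℝ) : ℂ)‖ =
        t ^ (1 - (n : ℝ) / 2) * ‖lam‖ ^ (-(1 - (n : ℝ) / 2)) := by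
      rw [Complex.norm_cpow_real, norm_div, Complex.norm_real, Real.norm_of_nonneg ht.le,
        Real.div_rpow ht.le hl.le, Real.rpow_neg hl.le, div_eq_mul_inv]
    have e2 : ‖((Real.pi : ℂ) / (2 * (lam * (t : ℂ)))) ^ (1 / 2 : ℂ)‖ =
        (Real.pi / (2 * ‖lam‖)) ^ (1 / 2 : ℝ) * t ^ (-(1 / 2) : ℝ) := by
      have := Real.pi_pos
      rw [show (1 / 2 : ℂ) = ((1 / 2 : ℝ) : ℂ) by norm_num, Complex.norm_cpow_real, norm_div,
        norm_mul, norm_mul, Complex.norm_real, Complex.norm_real, Real.norm_of_nonneg ht.le,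
        Real.norm_of_nonneg Real.pi_pos.le, Complex.norm_ofNat, ← mul_assoc, ← div_div,
        Real.div_rpow (by positivity) ht.le, Real.rpow_neg ht.le, ← div_eq_mul_inv]
    have e3 : ‖Complex.exp (-(lam * (t : ℂ)))‖ = Real.exp (-(lam.re * t)) := by
      rw [Complex.norm_exp]; simp
    have e4 : ‖besselK ν (lam * (t : ℂ))‖ ≤ (Real.pi / (2 * ‖lam‖)) ^ (1 / 2 : ℝ) *
        t ^ (-(1 / 2) : ℝ) * Real.exp (-(lam.re * t)) / Real.Gamma (|ν| + 1 / 2) *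
          (C * (1 + t ^ (-max 0 μ))) := by
      rw [besselK, norm_mul, norm_div, norm_mul, e2, e3, Complex.norm_real,
        Real.norm_of_nonneg hΓ.le]
      have := Real.pi_pos
      gcongr
      exact hI t ht
    rw [fundSol, if_neg h0, norm_mul, norm_mul, e1, Complex.norm_real,
      Real.norm_of_nonneg (by have := Real.pi_pos; positivity)]
    have hp := Real.pi_pos
    refine (mul_le_mul_of_nonneg_left e4 (by positivity)).trans (le_of_eq ?_)
    rw [hA]; ring
  have hq : ∀ e : ℝ, e ≤ 0 → -singExp n ≤ e → t ^ e ≤ max 1 (t ^ (-singExp n)) := fun e he hq =>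
    rpow_le_max_one_rpow_neg ht he hq
  have hexp : Real.exp (-(lam.re * t)) ≤ Real.exp (max 0 (-lam.re) * t) := by
    rw [← neg_mul]
    gcongr
    exact le_max_right _ _
  have hpow : t ^ (1 - (n : ℝ) / 2) * t ^ (-(1 / 2) : ℝ) * (1 + t ^ (-max 0 μ)) ≤
      2 * max 1 (t ^ (-singExp n)) := by
    rw [← Real.rpow_add ht, mul_add, mul_one, ← Real.rpow_add ht, two_mul]
    have hs1 : (n : ℝ) - 3 / 2 ≤ singExp n := le_max_right _ _
    have hs0 := singExp_nonneg n
    have hm0 : 0 ≤ max 0 μ := le_max_left _ _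
    have hm : max 0 μ ≤ (1 - (n : ℝ)) / 2 + singExp n := by
      rcases (show n = 1 ∨ n = 2 ∨ 3 ≤ n by omega) with rfl | rfl | h3
      · have : μ = 0 := by rw [hμ, hν]; norm_num [abs_of_neg]
        rw [this]; norm_num; exact hs0
      · have : μ ≤ 0 := by rw [hμ, hν]; norm_num
        rw [max_eq_left this]; push_cast at hs1 ⊢; linarith
      · have h3' : (3 : ℝ) ≤ n := by exact_mod_cast h3
        have : μ = (n : ℝ) / 2 - 1 - 1 / 2 := by rw [hμ, abs_of_nonneg (by linarith)]
        refine max_le ?_ ?_ <;> linarith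
    refine add_le_add (hq _ (by linarith) (by linarith)) (hq _ (by linarith) (by linarith))
  calc ‖fundSol lam z‖ ≤ _ := key
    _ ≤ A * Real.exp (max 0 (-lam.re) * t) * (2 * max 1 (t ^ (-singExp n))) := by gcongr
    _ = _ := by ring

lemma exists_norm_fundSol_zero_two_le : ∃ C > (0 : ℝ), ∀ z : Euc 2,
      ‖fundSol 0 z‖ ≤ C * max 1 (‖z‖ ^ (-singExp 2)) * (1 + ‖z‖) := by
  refine ⟨2, by norm_num, fun z => ?_⟩
  have hp := Real.pi_gt_three
  have hs : singExp 2 = 1 / 2 := by rw [singExp]; norm_num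
  rcases eq_or_ne z 0 with rfl | hz
  · simp [fundSol]
  have ht : 0 < ‖z‖ := norm_pos_iff.2 hz
  set t := ‖z‖
  have h1 : ‖fundSol 0 z‖ ≤ |Real.log t| := by
    simp only [fundSol, if_true]
    rw [Complex.norm_real, Real.norm_eq_abs, abs_mul, one_div t, Real.log_inv, abs_neg,
      abs_of_pos (by positivity)]
    refine mul_le_of_le_one_left (abs_nonneg _) ?_
    rw [div_le_one (by positivity)]; linarith
  refine h1.trans ?_
  rw [hs]
  have hm1 := le_max_left 1 (t ^ (-(1 / 2) : ℝ))
  have hm2 := le_max_right 1 (t ^ (-(1 / 2) : ℝ))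
  rcases le_total t 1 with h | h
  · rw [abs_of_nonpos (Real.log_nonpos ht.le h), ← Real.log_inv]
    have h2 := Real.log_le_rpow_div (x := t⁻¹) (by positivity) (ε := 1 / 2) (by norm_num)
    rw [Real.inv_rpow ht.le, ← Real.rpow_neg ht.le] at h2
    nlinarith
  · rw [abs_of_nonneg (Real.log_nonneg h)]
    have h2 := Real.log_le_sub_one_of_pos ht
    nlinarith

lemma exists_norm_fundSol_zero_le {n : ℕ} (hn : 3 ≤ n) : ∃ C > (0 : ℝ), ∀ z : Euc n,
      ‖fundSol 0 z‖ ≤ C * max 1 (‖z‖ ^ (-singExp n)) := by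
  have hp := Real.pi_pos
  have hn' : (3 : ℝ) ≤ n := by exact_mod_cast hn
  have hΓ : 0 < Real.Gamma ((n : ℝ) / 2 - 1) := Real.Gamma_pos_of_pos (by linarith)
  refine ⟨Real.Gamma ((n : ℝ) / 2 - 1) / (4 * Real.pi ^ ((n : ℝ) / 2)), by positivity,
    fun z => ?_⟩
  simp only [fundSol, if_true, if_neg (show n ≠ 2 by omega)]
  rw [Complex.norm_real, Real.norm_of_nonneg (by positivity)]
  gcongr
  rcases eq_or_ne z 0 with rfl | hz
  · rw [norm_zero, Real.zero_rpow (by linarith)]; simp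
  have ht : 0 < ‖z‖ := norm_pos_iff.2 hz
  rw [one_div, ← Real.rpow_neg ht.le]
  have hs1 : (n : ℝ) - 3 / 2 ≤ singExp n := le_max_right _ _
  exact rpow_le_max_one_rpow_neg ht (by linarith) (by linarith)

lemma measurable_fundSol {n : ℕ} (lam : ℂ) : Measurable (fundSol lam : Euc n → ℂ) := by
  have hB : Measurable (besselK ((n : ℝ) / 2 - 1)) := by
    refine Measurable.mul (by fun_prop) ?_
    refine StronglyMeasurable.measurable (StronglyMeasurable.integral_prod_right'
      (f := fun p : ℂ × ℝ =>
      ((Real.exp (-p.2) * p.2 ^ (|(n : ℝ) / 2 - 1| - 1 / 2) : ℝ) : ℂ) *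
        (1 + (p.2 : ℂ) / (2 * p.1)) ^ ((|(n : ℝ) / 2 - 1| - 1 / 2 : ℝ) : ℂ)) ?_)
    exact Measurable.stronglyMeasurable (by fun_prop)
  unfold fundSol
  split_ifs
  · fun_prop
  · fun_prop
  · exact (by fun_prop : Measurable _).mul (hB.comp (by fun_prop))

/-- A dyadic majorant of the singularity `‖z‖^(3/2 - n)`, as a superposition of indicator functions
of balls: its integral over a set is a sum of volumes of intersections with balls. -/
noncomputable def dyadicKernel (n : ℕ) (z : Euc n) : ℝ≥0∞ :=
  ∑' j : ℕ, (ball (0 : Euc n) (2 * (1 / 2) ^ j)).indicator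
    (fun _ => ENNReal.ofReal ((2 ^ j) ^ ((n : ℝ) - 3 / 2))) z

lemma measurable_dyadicKernel (n : ℕ) : Measurable (dyadicKernel n) :=
  Measurable.tsum fun _ => measurable_const.indicator measurableSet_ball

lemma ofReal_max_one_rpow_le {n : ℕ} (hn : 1 ≤ n) {z : Euc n} (hz : ‖z‖ ≤ 1) :
    ENNReal.ofReal (max 1 (‖z‖ ^ (-singExp n))) ≤
      ENNReal.ofReal (2 ^ singExp n) * (dyadicKernel n z + 1) := by
  have hs0 := singExp_nonneg n
  have h1 : (1 : ℝ≥0∞) ≤ ENNReal.ofReal (2 ^ singExp n) :=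
    ENNReal.one_le_ofReal.2 (Real.one_le_rpow (by norm_num) hs0)
  have hone : (1 : ℝ≥0∞) ≤ ENNReal.ofReal (2 ^ singExp n) * (dyadicKernel n z + 1) :=
    h1.trans (le_mul_of_one_le_right' le_add_self)
  rcases eq_or_ne z 0 with rfl | hz0
  · rw [norm_zero, max_eq_left, ENNReal.ofReal_one]
    · exact hone
    · exact (Real.zero_rpow_le_one _)
  have ht : 0 < ‖z‖ := norm_pos_iff.2 hz0
  rcases (show n = 1 ∨ 2 ≤ n by omega) with rfl | h2
  · have : singExp 1 = 0 := by rw [singExp]; norm_num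
    rw [this, neg_zero, Real.rpow_zero, max_self, ENNReal.ofReal_one, ← this]
    exact hone
  have hn2 : (2 : ℝ) ≤ n := by exact_mod_cast h2
  have hs : singExp n = n - 3 / 2 := max_eq_right (by linarith)
  rw [ENNReal.ofReal_max, ENNReal.ofReal_one]
  refine max_le hone ?_
  obtain ⟨j, hj1, hj2⟩ := exists_nat_pow_near_of_lt_one ht hz (y := (1 / 2 : ℝ)) (by norm_num)
    (by norm_num)
  have h3 : ENNReal.ofReal ((2 ^ j) ^ ((n : ℝ) - 3 / 2)) ≤ dyadicKernel n z := by
    refine le_trans (le_of_eq ?_) (ENNReal.le_tsum j)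
    rw [indicator_of_mem]
    rw [mem_ball_zero_iff]
    have : (0 : ℝ) < (1 / 2) ^ j := by positivity
    linarith
  refine le_trans ?_ (mul_le_mul_right (h3.trans le_self_add) _)
  rw [← ENNReal.ofReal_mul (by positivity)]
  refine ENNReal.ofReal_le_ofReal ?_
  rw [← hs, ← Real.mul_rpow (by norm_num) (by positivity), Real.rpow_neg ht.le,
    ← Real.inv_rpow ht.le]
  gcongr
  rw [inv_le_comm₀ ht (by positivity)]
  refine le_trans (le_of_eq ?_) hj1.le
  rw [pow_succ, one_div, mul_inv, inv_pow]; ring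

/-- A kernel with an admissible singularity and growth `G` is dominated by the dyadic majorant
near the origin and by `G` away from it. -/
lemma exists_enorm_le_dyadicKernel_add {n : ℕ} (hn : 1 ≤ n) {k : Euc n → ℂ} {G : ℝ → ℝ}
    (hG : MonotoneOn G (Ici 0)) (hG1 : ∀ t ≥ 0, 1 ≤ G t) {C : ℝ} (hC : 0 < C)
    (hk : ∀ z, ‖k z‖ ≤ C * max 1 (‖z‖ ^ (-singExp n)) * G ‖z‖) :
    ∃ C' : ℝ≥0, ∀ z, ‖k z‖ₑ ≤ C' * (dyadicKernel n z + ENNReal.ofReal (G ‖z‖)) := by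
  have hs0 := singExp_nonneg n
  have h2s : (1 : ℝ) ≤ 2 ^ singExp n := Real.one_le_rpow (by norm_num) hs0
  have hG1' := hG1 1 zero_le_one
  refine ⟨(C * G 1 * 2 ^ singExp n).toNNReal, fun z => ?_⟩
  rw [← ofReal_norm]
  change _ ≤ ENNReal.ofReal _ * _
  rcases le_or_gt ‖z‖ 1 with h | h
  · calc ENNReal.ofReal ‖k z‖ ≤ ENNReal.ofReal (C * G 1 * max 1 (‖z‖ ^ (-singExp n))) := by
          refine ENNReal.ofReal_le_ofReal ((hk z).trans ?_)
          rw [mul_right_comm]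
          gcongr
          exact hG (norm_nonneg z) (mem_Ici.2 zero_le_one) h
      _ = ENNReal.ofReal (C * G 1) * ENNReal.ofReal (max 1 (‖z‖ ^ (-singExp n))) :=
          ENNReal.ofReal_mul (by positivity)
      _ ≤ ENNReal.ofReal (C * G 1) *
          (ENNReal.ofReal (2 ^ singExp n) * (dyadicKernel n z + 1)) := by
          gcongr; exact ofReal_max_one_rpow_le hn h
      _ = ENNReal.ofReal (C * G 1 * 2 ^ singExp n) * (dyadicKernel n z + 1) := by
          rw [← mul_assoc, ← ENNReal.ofReal_mul (by positivity)]
      _ ≤ _ := by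
          gcongr
          exact ENNReal.one_le_ofReal.2 (hG1 _ (norm_nonneg z))
  · have h1 : max 1 (‖z‖ ^ (-singExp n)) = 1 :=
      max_eq_left (Real.rpow_le_one_of_one_le_of_nonpos h.le (by linarith))
    have hz := hk z
    rw [h1, mul_one] at hz
    have hGz := hG1 _ (norm_nonneg z)
    calc ENNReal.ofReal ‖k z‖ ≤ ENNReal.ofReal (C * G 1 * 2 ^ singExp n * G ‖z‖) := by
          refine ENNReal.ofReal_le_ofReal (hz.trans ?_)
          gcongr
          rw [mul_assoc]
          exact le_mul_of_one_le_right hC.le (one_le_mul_of_one_le_of_one_le hG1' h2s)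
      _ = ENNReal.ofReal (C * G 1 * 2 ^ singExp n) * ENNReal.ofReal (G ‖z‖) :=
          ENNReal.ofReal_mul (by positivity)
      _ ≤ _ := by gcongr; exact le_add_self

/-- Sets occupying a fraction `O(t / r)` of each ball of radius `r` carry `O(t)` of the singular
kernel, as `∑ 2^{j (n - 3/2)} 2^{-j (n - 1)} = ∑ 2^{-j/2}` converges. -/
lemma exists_setLIntegral_dyadicKernel_le {n : ℕ} (hn : 1 ≤ n) : ∃ C : ℝ≥0,
    ∀ (S : Set (Euc n)) (a : ℝ≥0∞) (x : Euc n),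
      (∀ r > 0, volume (S ∩ ball x r) ≤ a * ENNReal.ofReal (r ^ (n - 1))) →
      ∫⁻ y in S, dyadicKernel n (x - y) ≤ C * a := by
  obtain ⟨k, rfl⟩ : ∃ k, n = k + 1 := ⟨n - 1, by omega⟩
  have hq0 : (0 : ℝ) < 2 ^ (-(1 / 2) : ℝ) := by positivity
  have hq1 : (2 : ℝ) ^ (-(1 / 2) : ℝ) < 1 := 
    Real.rpow_lt_one_of_one_lt_of_neg (by norm_num) (by norm_num)
  have hsum := (summable_geometric_of_lt_one hq0.le hq1).mul_left ((2 : ℝ) ^ k)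
  refine ⟨(∑' j : ℕ, (2 : ℝ) ^ k * ((2 : ℝ) ^ (-(1 / 2) : ℝ)) ^ j).toNNReal,
    fun S a x hS => ?_⟩
  have hterm : ∀ j : ℕ, ∫⁻ y in S, (ball (0 : Euc (k + 1)) (2 * (1 / 2) ^ j)).indicator
      (fun _ => ENNReal.ofReal ((2 ^ j) ^ (((k + 1 : ℕ) : ℝ) - 3 / 2))) (x - y) ≤
      ENNReal.ofReal ((2 : ℝ) ^ k * ((2 : ℝ) ^ (-(1 / 2) : ℝ)) ^ j) * a := by
    intro j
    have e : ∀ y, (ball (0 : Euc (k + 1)) (2 * (1 / 2) ^ j)).indicator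
      (fun _ => ENNReal.ofReal ((2 ^ j) ^ (((k + 1 : ℕ) : ℝ) - 3 / 2))) (x - y) =
      (ball x (2 * (1 / 2) ^ j)).indicator
        (fun _ => ENNReal.ofReal ((2 ^ j) ^ (((k + 1 : ℕ) : ℝ) - 3 / 2))) y := by
      intro y
      have : x - y ∈ ball (0 : Euc (k + 1)) (2 * (1 / 2) ^ j) ↔ y ∈ ball x (2 * (1 / 2) ^ j) := by
        rw [mem_ball_zero_iff, mem_ball, dist_comm, dist_eq_norm]
      by_cases h : y ∈ ball x (2 * (1 / 2) ^ j)
      · rw [indicator_of_mem h, indicator_of_mem (this.2 h)]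
      · rw [indicator_of_notMem h, indicator_of_notMem (mt this.1 h)]
    simp_rw [e]
    rw [lintegral_indicator_const measurableSet_ball, Measure.restrict_apply measurableSet_ball,
      inter_comm]
    refine (mul_le_mul_right (hS _ (by positivity)) _).trans (le_of_eq ?_)
    rw [Nat.add_sub_cancel, mul_left_comm, ← ENNReal.ofReal_mul (by positivity), mul_comm]
    congr 2
    have e1 : ((2 : ℝ) ^ j) ^ (((k + 1 : ℕ) : ℝ) - 3 / 2) =
        (2 ^ j) ^ k * ((2 : ℝ) ^ (-(1 / 2) : ℝ)) ^ j := by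
      rw [Real.rpow_pow_comm (by norm_num), ← Real.rpow_natCast (2 ^ j) k,
        ← Real.rpow_add (by positivity)]
      congr 1
      push_cast
      ring
    have e2 : ((2 : ℝ) ^ j) ^ k * ((1 / 2) ^ j) ^ k = 1 := by
      rw [← mul_pow, ← mul_pow]; norm_num
    rw [e1, mul_pow]
    linear_combination 2 ^ k * ((2 : ℝ) ^ (-(1 / 2) : ℝ)) ^ j * e2
  unfold dyadicKernel
  have hmeas : ∀ j : ℕ, AEMeasurable (fun y => (ball (0 : Euc (k + 1)) (2 * (1 / 2) ^ j)).indicator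
      (fun _ => ENNReal.ofReal ((2 ^ j) ^ (((k + 1 : ℕ) : ℝ) - 3 / 2))) (x - y))
      (volume.restrict S) := fun j =>
    ((measurable_const.indicator measurableSet_ball).comp
      (by fun_prop : Measurable fun y : Euc (k + 1) => x - y)).aemeasurable
  rw [lintegral_tsum hmeas]
  refine (ENNReal.tsum_le_tsum hterm).trans ?_
  rw [ENNReal.tsum_mul_right, ← ENNReal.ofReal_tsum_of_nonneg (fun j => by positivity) hsum]
  rfl

/-! ### Potentials of boundary layers -/

section Layers
variable {n : ℕ} {Ω : Set (Euc n)}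

/-- The layer of width `t` around `∂Ω` carries `O(t)` of the singular kernel, up to polynomial
factors for large `t`. -/
lemma exists_setLIntegral_layer_le (hn : 1 ≤ n) (hΩ : IsOpen Ω) (hb : Bornology.IsBounded Ω)
    (hC2 : HasC2Boundary Ω) (hne : (frontier Ω).Nonempty) :
    ∃ C : ℝ≥0, ∀ t > 0, ∀ x,
      ∫⁻ y in {y | infDist y (frontier Ω) ≤ t}, (dyadicKernel n (x - y) + 1) ≤
        C * ENNReal.ofReal (t * (1 + t) ^ (n - 1)) := by
  obtain ⟨C₁, h₁⟩ := exists_volume_layer_inter_ball_le hn hΩ hb hC2 hne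
  obtain ⟨C₂, h₂⟩ := exists_setLIntegral_dyadicKernel_le hn
  have hcpt : IsCompact (frontier Ω) :=
    Metric.isCompact_of_isClosed_isBounded isClosed_frontier
      (hb.closure.subset frontier_subset_closure)
  obtain ⟨R, hR, hRb⟩ := hcpt.isBounded.subset_ball_lt 0 (0 : Euc n)
  refine ⟨C₂ * C₁ + C₁ * (Real.toNNReal ((1 + R) ^ (n - 1))), fun t ht x => ?_⟩
  have hm : Measurable fun y => dyadicKernel n (x - y) :=
    (measurable_dyadicKernel n).comp (by fun_prop)
  rw [lintegral_add_left hm, setLIntegral_one, ENNReal.coe_add, add_mul, ENNReal.coe_mul,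
    ENNReal.coe_mul]
  have ht1 : t ≤ t * (1 + t) ^ (n - 1) :=
    le_mul_of_one_le_right ht.le (one_le_pow₀ (by linarith))
  refine add_le_add ?_ ?_
  · refine (h₂ _ (C₁ * ENNReal.ofReal t) x fun r hr => ?_).trans ?_
    · rw [mul_assoc, ← ENNReal.ofReal_mul ht.le]
      exact h₁ t ht x r hr
    · rw [mul_assoc]
      gcongr
  · have hsub : {y | infDist y (frontier Ω) ≤ t} ⊆
        {y | infDist y (frontier Ω) ≤ t} ∩ ball (0 : Euc n) (R + t) := by
      intro y hy
      refine ⟨hy, ?_⟩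
      obtain ⟨q, hq, hqd⟩ := hcpt.exists_infDist_eq_dist hne y
      have e1 : dist y q ≤ t := hqd ▸ hy
      have e2 := hRb hq
      rw [mem_ball] at e2 ⊢
      linarith [dist_triangle y q 0]
    refine (measure_mono hsub).trans ((h₁ t ht 0 (R + t) (by positivity)).trans ?_)
    rw [mul_assoc]
    gcongr
    change _ ≤ ENNReal.ofReal _ * _
    rw [← ENNReal.ofReal_mul (by positivity)]
    refine ENNReal.ofReal_le_ofReal ?_
    have : (R + t) ^ (n - 1) ≤ ((1 + R) * (1 + t)) ^ (n - 1) := by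
      gcongr; nlinarith
    rw [mul_pow] at this
    calc t * (R + t) ^ (n - 1) ≤ t * ((1 + R) ^ (n - 1) * (1 + t) ^ (n - 1)) := by gcongr
      _ = _ := by ring

/-- A function decaying with `d(y, ∂Ω) / s²` has a potential of size `O(s²)`. -/
lemma exists_lintegral_decay_le (hn : 1 ≤ n) (hΩ : IsOpen Ω) (hb : Bornology.IsBounded Ω)
    (hC2 : HasC2Boundary Ω) (hne : (frontier Ω).Nonempty) :
    ∃ C : ℝ≥0, ∀ s > 0, s ≤ 1 → ∀ x, ∫⁻ y, (dyadicKernel n (x - y) + 1) *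
      ENNReal.ofReal (((1 + infDist y (frontier Ω) / s ^ 2) ^ (n + 2))⁻¹) ≤
        C * ENNReal.ofReal (s ^ 2) := by
  obtain ⟨C, hC⟩ := exists_setLIntegral_layer_le hn hΩ hb hC2 hne
  have hsum : Summable fun j : ℕ => (2 : ℝ) ^ (n - 1) * (((j : ℝ) + 1) ^ 2)⁻¹ := by
    refine Summable.mul_left _ ?_
    have := (summable_nat_add_iff 1).2 (Real.summable_nat_pow_inv (p := 2).2 (by norm_num))
    simpa using this
  refine ⟨C * Real.toNNReal (∑' j : ℕ, (2 : ℝ) ^ (n - 1) * (((j : ℝ) + 1) ^ 2)⁻¹),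
    fun s hs hs1 x => ?_⟩
  have hs2 : 0 < s ^ 2 := by positivity
  let L : ℕ → Set (Euc n) := fun j => {y | infDist y (frontier Ω) ≤ (j + 1) * s ^ 2}
  have hL : ∀ j, MeasurableSet (L j) := fun j =>
    (isClosed_le (continuous_infDist_pt _) continuous_const).measurableSet
  have hm : Measurable fun y => dyadicKernel n (x - y) + 1 :=
    ((measurable_dyadicKernel n).comp (by fun_prop)).add_const 1
  have hpt : ∀ y, (dyadicKernel n (x - y) + 1) *
      ENNReal.ofReal (((1 + infDist y (frontier Ω) / s ^ 2) ^ (n + 2))⁻¹) ≤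
      ∑' j : ℕ, ENNReal.ofReal ((((j : ℝ) + 1) ^ (n + 2))⁻¹) *
        (L j).indicator (fun y => dyadicKernel n (x - y) + 1) y := by
    intro y
    set d := infDist y (frontier Ω)
    have hd : 0 ≤ d / s ^ 2 := div_nonneg infDist_nonneg hs2.le
    refine le_trans ?_ (ENNReal.le_tsum ⌊d / s ^ 2⌋₊)
    have hy : y ∈ L ⌊d / s ^ 2⌋₊ := by
      change d ≤ _
      rw [← div_le_iff₀ hs2]
      exact (Nat.lt_floor_add_one _).le
    have h3 : (⌊d / s ^ 2⌋₊ : ℝ) + 1 ≤ 1 + d / s ^ 2 := by linarith [Nat.floor_le hd]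
    rw [indicator_of_mem hy, mul_comm]
    refine mul_le_mul_left (ENNReal.ofReal_le_ofReal ?_) _
    exact inv_anti₀ (by positivity) (pow_le_pow_left₀ (by positivity) h3 _)
  calc _ ≤ ∫⁻ y, ∑' j : ℕ, ENNReal.ofReal ((((j : ℝ) + 1) ^ (n + 2))⁻¹) *
        (L j).indicator (fun y => dyadicKernel n (x - y) + 1) y := lintegral_mono hpt
    _ = ∑' j : ℕ, ENNReal.ofReal ((((j : ℝ) + 1) ^ (n + 2))⁻¹) *
        ∫⁻ y in L j, (dyadicKernel n (x - y) + 1) := by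
      rw [lintegral_tsum fun j => ((hm.indicator (hL j)).const_mul _).aemeasurable]
      congr 1
      ext j
      rw [lintegral_const_mul _ (hm.indicator (hL j)), lintegral_indicator (hL j)]
    _ ≤ ∑' j : ℕ, ENNReal.ofReal ((2 : ℝ) ^ (n - 1) * (((j : ℝ) + 1) ^ 2)⁻¹) *
        (C * ENNReal.ofReal (s ^ 2)) := by
      refine ENNReal.tsum_le_tsum fun j => ?_
      refine (mul_le_mul_right (hC ((j + 1) * s ^ 2) (by positivity) x) _).trans ?_
      rw [mul_left_comm (ENNReal.ofReal (((j : ℝ) + 1) ^ (n + 2))⁻¹),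
        mul_left_comm (ENNReal.ofReal ((2 : ℝ) ^ (n - 1) * (((j : ℝ) + 1) ^ 2)⁻¹)),
        ← ENNReal.ofReal_mul (by positivity), ← ENNReal.ofReal_mul (by positivity)]
      refine mul_le_mul_right (ENNReal.ofReal_le_ofReal ?_) _
      obtain ⟨k, rfl⟩ : ∃ k, n = k + 1 := ⟨n - 1, by omega⟩
      rw [Nat.add_sub_cancel]
      have hj : (0 : ℝ) ≤ j := j.cast_nonneg
      have h1 : s ^ 2 ≤ 1 := pow_le_one₀ hs.le hs1
      have h2 : 1 + ((j : ℝ) + 1) * s ^ 2 ≤ 2 * (j + 1) := by nlinarith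
      calc _ ≤ (((j : ℝ) + 1) ^ (k + 1 + 2))⁻¹ *
            ((j + 1) * s ^ 2 * (2 * (j + 1)) ^ k) := by gcongr
        _ = _ := by
          rw [mul_pow]
          field_simp
          ring
    _ = _ := by
      rw [ENNReal.tsum_mul_right, ← ENNReal.ofReal_tsum_of_nonneg (fun j => by positivity) hsum,
        ENNReal.coe_mul]
      change _ = _ * ENNReal.ofReal _ * _
      ring

lemma exists_setLIntegral_domain_le (hn : 1 ≤ n) (hΩ : IsOpen Ω) (hb : Bornology.IsBounded Ω)
    (hC2 : HasC2Boundary Ω) (hne : (frontier Ω).Nonempty) :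
    ∃ C : ℝ≥0, ∀ x, ∫⁻ y in Ω, (dyadicKernel n (x - y) + 1) ≤ C := by
  obtain ⟨C, hC⟩ := exists_setLIntegral_layer_le hn hΩ hb hC2 hne
  obtain ⟨q, hq⟩ := hne
  obtain ⟨R, hR, hRb⟩ := hb.subset_ball_lt 0 q
  refine ⟨C * Real.toNNReal (R * (1 + R) ^ (n - 1)), fun x => ?_⟩
  rw [ENNReal.coe_mul]
  refine (lintegral_mono_set fun y hy => ?_).trans (hC R hR x)
  exact (infDist_le_dist_of_mem hq).trans (mem_ball.1 (hRb hy)).le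

end Layers

/-! ### Quasi-interpolation -/

section QuasiInterpolation
variable {n : ℕ}

/-- The consequences used of a bound `M` for the derivatives of `F` up to order two: bounds for `F`
and its gradient, and a global second order Taylor estimate. -/
structure IsTaylorBound (F : Euc n → ℂ) (M : ℝ) : Prop where
  norm_le : ∀ y, ‖F y‖ ≤ M
  norm_fderiv_le : ∀ y, ‖fderiv ℝ F y‖ ≤ M
  norm_sub_le : ∀ p y, ‖F p - F y - fderiv ℝ F y (p - y)‖ ≤ M * ‖p - y‖ ^ 2

lemma IsTaylorBound.nonneg {F : Euc n → ℂ} {M : ℝ} (h : IsTaylorBound F M) : 0 ≤ M :=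
  (norm_nonneg _).trans (h.norm_le 0)

lemma isTaylorBound_sobolevSupNorm {N : ℕ} (hN : 2 ≤ N) {F : Euc n → ℂ} (hF : ContDiff ℝ N F)
    (hfin : sobolevSupNorm N univ F ≠ ⊤) :
    IsTaylorBound F (sobolevSupNorm N univ F).toReal := by
  have hk : ∀ k ≤ N, ∀ y, ‖iteratedFDeriv ℝ k F y‖ ≤ (sobolevSupNorm N univ F).toReal := by
    intro k hk y
    have : ‖iteratedFDeriv ℝ k F y‖ₑ ≤ sobolevSupNorm N univ F :=
      le_iSup₂_of_le k hk (le_iSup₂_of_le y (mem_univ y) le_rfl)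
    have := ENNReal.toReal_mono hfin this
    simpa using this
  set M := (sobolevSupNorm N univ F).toReal
  have hF2 : ContDiff ℝ 2 F := hF.of_le (by exact_mod_cast hN)
  have hd : Differentiable ℝ F := hF2.differentiable (by norm_num)
  have hd' : Differentiable ℝ (fderiv ℝ F) :=
    (hF2.fderiv_right (m := 1) (by norm_num)).differentiable (by norm_num)
  have hM : 0 ≤ M := ENNReal.toReal_nonneg
  refine ⟨fun y => ?_, fun y => ?_, fun p y => ?_⟩
  · simpa using hk 0 (by omega) y
  · simpa [norm_iteratedFDeriv_one] using hk 1 (by omega) y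
  · have hlip : ∀ z, ‖fderiv ℝ F z - fderiv ℝ F y‖ ≤ M * ‖z - y‖ := fun z =>
      Convex.norm_image_sub_le_of_norm_fderiv_le (𝕜 := ℝ) (s := univ) (fun w _ => hd' w)
        (fun w _ => by
          have := hk 2 hN w
          rwa [← norm_iteratedFDeriv_fderiv, norm_iteratedFDeriv_one] at this)
        convex_univ (mem_univ _) (mem_univ _)
    have := Convex.norm_image_sub_le_of_norm_fderiv_le' (𝕜 := ℝ) (f := F) (φ := fderiv ℝ F y)
      (s := closedBall y ‖p - y‖) (C := M * ‖p - y‖) (fun z _ => hd z)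
      (fun z hz => (hlip z).trans (by
        gcongr
        rw [← dist_eq_norm]; exact hz))
      (convex_closedBall _ _) (x := y) (y := p) (by simp) (by simp [dist_eq_norm])
    rw [sq, ← mul_assoc]
    exact this

/-- The generating function times a coordinate. -/
lemma exists_schwartz_coord_mul (η : 𝓢(Euc n, ℂ)) (i : Fin n) :
    ∃ g : 𝓢(Euc n, ℂ), ∀ z, g z = η z * ((z i : ℝ) : ℂ) := by
  have hg : (fun z : Euc n => z i).HasTemperateGrowth :=
    (EuclideanSpace.proj (𝕜 := ℝ) i : Euc n →L[ℝ] ℝ).hasTemperateGrowth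
  refine ⟨SchwartzMap.smulLeftCLM ℂ (fun z : Euc n => z i) η, fun z => ?_⟩
  rw [SchwartzMap.smulLeftCLM_apply_apply hg, Complex.real_smul, mul_comm]

lemma MomentCondition.integral_eq_one {N : ℕ} (hN : 2 ≤ N) {η : Euc n → ℂ}
    (h : MomentCondition N η) : ∫ z, η z = 1 := by
  simpa using h 0 (by simp; omega)

lemma MomentCondition.integral_coord_eq_zero {N : ℕ} (hN : 2 ≤ N) {η : Euc n → ℂ}
    (h : MomentCondition N η) (i : Fin n) : ∫ z : Euc n, η z * ((z i : ℝ) : ℂ) = 0 := by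
  have h1 := h (Pi.single i 1) (by rw [Finset.sum_pi_single']; simp; omega)
  rw [if_neg (by simp)] at h1
  rw [← h1]
  congr 1
  ext z
  congr 2
  rw [Finset.prod_eq_single i (fun j _ hj => by simp [hj]) (by simp)]
  simp

lemma gridPoint_eq_smul (h : ℝ) (m : Fin n → ℤ) : gridPoint h m = h • gridPoint 1 m := by
  ext i; simp [gridPoint]

/-- The quasi-interpolant reproduces smooth functions up to a second order term and a saturation
error, which is small for a fine lattice (`τ`) and few neglected nodes (`r`). -/
lemma exists_norm_quasiInterpolant_sub_le {N : ℕ} (hN : 2 ≤ N) (η : 𝓢(Euc n, ℂ))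
    (hη : MomentCondition N η) : ∃ C > (0 : ℝ), ∀ τ : ℝ, 0 < τ → τ ≤ 1 → ∀ s > 0, s ≤ 1 →
      ∀ r > 0, ∀ (y : Euc n) (S : Finset (Fin n → ℤ)),
      (∀ m, ‖s⁻¹ • (y - gridPoint (s * τ) m)‖ ≤ r → m ∈ S) →
      ∀ (F : Euc n → ℂ) (M : ℝ), IsTaylorBound F M →
      ‖∑ m ∈ S, (τ ^ n : ℝ) • (F (gridPoint (s * τ) m) * η (s⁻¹ • (y - gridPoint (s * τ) m))) - F y‖
        ≤ C * (τ + (1 + r)⁻¹ + s ^ 2) * M := by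
  obtain ⟨C₀, hC₀, h₀⟩ := exists_tsum_inv_pow_le n
  obtain ⟨A, hA, hηA⟩ := η.exists_norm_le_inv_pow (n + 1 + 2) 0
  simp only [norm_iteratedFDeriv_zero] at hηA
  obtain ⟨C₁, hC₁, h₁⟩ := η.exists_norm_tsum_sub_integral_le
  choose g hg using exists_schwartz_coord_mul η
  choose C₂ hC₂ h₂ using fun i => (g i).exists_norm_tsum_sub_integral_le
  have hsum2 : 0 ≤ ∑ i, C₂ i := Finset.sum_nonneg fun i _ => (hC₂ i).le
  refine ⟨C₁ + ∑ i, C₂ i + A * C₀, by positivity, ?_⟩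
  intro τ hτ hτ1 s hs hs1 r hr y S hS F M hF
  have hM := hF.nonneg
  set t : Euc n := (s * τ)⁻¹ • y with ht
  set z : (Fin n → ℤ) → Euc n := fun m => τ • (t - gridPoint 1 m) with hz
  have hzeq : ∀ m, s⁻¹ • (y - gridPoint (s * τ) m) = z m := by
    intro m
    rw [hz, ht, gridPoint_eq_smul (s * τ)]
    simp only [smul_sub, smul_smul]
    congr 2 <;> field_simp
  have hgrid : ∀ m, gridPoint (s * τ) m - y = -(s • z m) := by
    intro m
    rw [← hzeq, smul_inv_smul₀ hs.ne', neg_sub]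
  simp only [hzeq] at hS ⊢
  obtain ⟨hw, hwC⟩ := h₀ τ hτ hτ1 t
  set w : (Fin n → ℤ) → ℝ := fun m => τ ^ n * ((1 + ‖z m‖) ^ (n + 1))⁻¹ with hwdef
  have hw0 : ∀ m, 0 ≤ w m := fun m => by positivity
  have hηw : ∀ m, τ ^ n * ‖η (z m)‖ ≤ A * w m * ((1 + ‖z m‖) ^ 2)⁻¹ := by
    intro m
    calc τ ^ n * ‖η (z m)‖ ≤ τ ^ n * (A * ((1 + ‖z m‖) ^ (n + 1 + 2))⁻¹) := by
          gcongr; exact hηA _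
      _ = _ := by rw [hwdef, pow_add _ (n + 1), mul_inv]; ring
  have hinv : ∀ m, ((1 + ‖z m‖) ^ 2)⁻¹ ≤ (1 + ‖z m‖)⁻¹ := by
    intro m
    gcongr
    exact le_self_pow₀ (by linarith [norm_nonneg (z m)]) (by norm_num)
  have hinv1 : ∀ m, (1 + ‖z m‖)⁻¹ ≤ 1 := fun m =>
    inv_le_one_of_one_le₀ (by linarith [norm_nonneg (z m)])
  set G : (Fin n → ℤ) → ℂ := fun m => (τ ^ n : ℝ) • (F (gridPoint (s * τ) m) * η (z m)) with hG
  have hGn : ∀ m, ‖G m‖ ≤ M * A * w m * (1 + ‖z m‖)⁻¹ := by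
    intro m
    rw [hG, norm_smul, norm_mul, Real.norm_of_nonneg (by positivity)]
    calc _ = ‖F (gridPoint (s * τ) m)‖ * (τ ^ n * ‖η (z m)‖) := by ring
      _ ≤ M * (A * w m * (1 + ‖z m‖)⁻¹) := by
        refine mul_le_mul (hF.norm_le _) ((hηw m).trans ?_) (by positivity) hM
        exact mul_le_mul_of_nonneg_left (hinv m) (mul_nonneg hA.le (hw0 m))
      _ = _ := by ring
  have hGs : Summable G := by
    refine Summable.of_norm_bounded (hw.mul_left (M * A)) fun m => (hGn m).trans ?_
    exact mul_le_of_le_one_right (by have := hw0 m; positivity) (hinv1 m)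
  -- neglected nodes
  have htail : ‖∑ m ∈ S, G m - ∑' m, G m‖ ≤ A * C₀ * (1 + r)⁻¹ * M := by
    rw [← hGs.sum_add_tsum_compl (s := S), sub_add_cancel_left, norm_neg]
    have hb : ∀ m : ↑((S : Set (Fin n → ℤ))ᶜ), ‖G m‖ ≤ (M * A * (1 + r)⁻¹) * w m := by
      rintro ⟨m, hm⟩
      have hzr : r ≤ ‖z m‖ := le_of_not_ge fun h => hm (hS m h)
      refine (hGn m).trans ?_
      have : (1 + ‖z m‖)⁻¹ ≤ (1 + r)⁻¹ := by gcongr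
      calc M * A * w m * (1 + ‖z m‖)⁻¹ ≤ M * A * w m * (1 + r)⁻¹ := by
            have := hw0 m; gcongr
        _ = _ := by ring
    refine (tsum_of_norm_bounded ((hw.mul_left _).subtype _).hasSum hb).trans ?_
    have hle : ∑' m : ↑((S : Set (Fin n → ℤ))ᶜ), (M * A * (1 + r)⁻¹) * w m ≤
        ∑' m, (M * A * (1 + r)⁻¹) * w m :=
      Summable.tsum_subtype_le _ _ (fun m => by have := hw0 m; positivity) (hw.mul_left _)
    refine hle.trans ?_
    rw [tsum_mul_left]
    calc _ ≤ M * A * (1 + r)⁻¹ * C₀ := by gcongr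
      _ = _ := by ring
  -- Taylor expansion about `y`
  obtain ⟨ha, haC⟩ := h₁ τ hτ hτ1 t
  have hbC := fun i => (h₂ i τ hτ hτ1 t).2
  have hbs := fun i => (h₂ i τ hτ hτ1 t).1
  rw [hη.integral_eq_one hN] at haC
  have hgi : ∀ i, ∫ z, g i z = 0 := fun i => by
    rw [← hη.integral_coord_eq_zero hN i]; congr 1; ext z; exact hg i z
  simp only [hgi, sub_zero] at hbC
  set a : (Fin n → ℤ) → ℂ := fun m => (τ ^ n : ℝ) • η (z m) with hadef
  set b : Fin n → (Fin n → ℤ) → ℂ := fun i m => (τ ^ n : ℝ) • g i (z m) with hbdef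
  set e : Fin n → ℂ := fun i => fderiv ℝ F y (EuclideanSpace.single i 1) with hedef
  have he : ∀ i, ‖e i‖ ≤ M := fun i => by
    refine ((fderiv ℝ F y).le_opNorm _).trans ?_
    simpa using hF.norm_fderiv_le y
  have hlin : ∀ v : Euc n, fderiv ℝ F y v = ∑ i, ((v i : ℝ) : ℂ) * e i := by
    intro v
    conv_lhs => rw [← (EuclideanSpace.basisFun (Fin n) ℝ).sum_repr v]
    simp [map_sum, hedef]
  set Rm : (Fin n → ℤ) → ℂ := fun m =>
    a m * (F (gridPoint (s * τ) m) - F y - fderiv ℝ F y (gridPoint (s * τ) m - y)) with hRdef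
  have hRn : ∀ m, ‖Rm m‖ ≤ M * s ^ 2 * A * w m := by
    intro m
    have h3 := hF.norm_sub_le (gridPoint (s * τ) m) y
    rw [hRdef, norm_mul, hadef, norm_smul, Real.norm_of_nonneg (by positivity)]
    rw [hgrid, norm_neg, norm_smul, Real.norm_of_nonneg hs.le] at h3
    have h4 : ((1 + ‖z m‖) ^ 2)⁻¹ * ‖z m‖ ^ 2 ≤ 1 := by
      rw [inv_mul_le_iff₀ (by positivity), mul_one]
      gcongr
      linarith
    have h5 := hw0 m
    rw [hgrid]
    calc _ ≤ A * w m * ((1 + ‖z m‖) ^ 2)⁻¹ * (M * (s * ‖z m‖) ^ 2) := by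
          exact mul_le_mul (hηw m) h3 (norm_nonneg _) (by positivity)
      _ = M * s ^ 2 * A * w m * (((1 + ‖z m‖) ^ 2)⁻¹ * ‖z m‖ ^ 2) := by ring
      _ ≤ _ := mul_le_of_le_one_right (by positivity) h4
  have hRC : ‖∑' m, Rm m‖ ≤ A * C₀ * s ^ 2 * M := by
    refine (tsum_of_norm_bounded (hw.mul_left (M * s ^ 2 * A)).hasSum hRn).trans ?_
    rw [tsum_mul_left]
    calc _ ≤ M * s ^ 2 * A * C₀ := by gcongr
      _ = _ := by ring
  have hRs : Summable Rm := Summable.of_norm_bounded (hw.mul_left (M * s ^ 2 * A)) hRn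
  have hGdec : ∀ m, G m = F y * a m - (s : ℂ) * ∑ i, e i * b i m + Rm m := by
    intro m
    have : (a m) * fderiv ℝ F y (gridPoint (s * τ) m - y) = -((s : ℂ) * ∑ i, e i * b i m) := by
      rw [hgrid, map_neg, map_smul, hlin, mul_neg, neg_inj, Complex.real_smul, mul_left_comm]
      congr 1
      rw [Finset.mul_sum]
      refine Finset.sum_congr rfl fun i _ => ?_
      simp only [hadef, hbdef, hg, Complex.real_smul]
      ring
    simp only [hRdef, mul_sub, this]
    simp only [hG, hadef, Complex.real_smul]
    ring
  have hGt : ∑' m, G m - F y =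
      F y * (∑' m, a m - 1) - (s : ℂ) * ∑ i, e i * ∑' m, b i m + ∑' m, Rm m := by
    have hs1 : HasSum (fun m => ∑ i, e i * b i m) (∑ i, e i * ∑' m, b i m) :=
      hasSum_sum fun i _ => (hbs i).hasSum.mul_left _
    have h6 := ((ha.hasSum.mul_left (F y)).sub (hs1.mul_left (s : ℂ))).add hRs.hasSum
    rw [← funext hGdec] at h6
    rw [h6.tsum_eq]
    ring
  have hmain : ‖∑' m, G m - F y‖ ≤ M * (C₁ * τ) + ∑ i, M * (C₂ i * τ) + A * C₀ * s ^ 2 * M := by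
    rw [hGt]
    refine (norm_add_le _ _).trans (add_le_add ((norm_sub_le _ _).trans (add_le_add ?_ ?_)) hRC)
    · rw [norm_mul]
      exact mul_le_mul (hF.norm_le y) haC (norm_nonneg _) hM
    · rw [norm_mul, Complex.norm_real, Real.norm_of_nonneg hs.le]
      refine (mul_le_of_le_one_left (norm_nonneg _) hs1).trans ((norm_sum_le _ _).trans ?_)
      refine Finset.sum_le_sum fun i _ => ?_
      rw [norm_mul]
      exact mul_le_mul (he i) (hbC i) (norm_nonneg _) hM
  rw [← Finset.mul_sum, ← Finset.sum_mul] at hmain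
  calc _ ≤ ‖∑ m ∈ S, G m - ∑' m, G m‖ + ‖∑' m, G m - F y‖ := norm_sub_le_norm_sub_add_norm_sub _ _ _
    _ ≤ A * C₀ * (1 + r)⁻¹ * M + (M * (C₁ * τ) + M * ((∑ i, C₂ i) * τ) + A * C₀ * s ^ 2 * M) :=
      add_le_add htail hmain
    _ ≤ _ := by
      have hr' : 0 ≤ (1 + r)⁻¹ := by positivity
      have hAC : 0 ≤ A * C₀ := by positivity
      have hs2 : 0 ≤ s ^ 2 := sq_nonneg s
      have e1 := mul_nonneg (mul_nonneg (add_nonneg hC₁.le hsum2) (add_nonneg hr' hs2)) hM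
      have e2 := mul_nonneg (mul_nonneg hAC hτ.le) hM
      nlinarith

end QuasiInterpolation

/-- A growth rate: a monotone submultiplicative function `ω ≥ 1` on `[0, ∞)`. It measures the growth
of the kernel at infinity, to be compensated by the decay of the generating function. -/
structure IsGrowthRate (ω : ℝ → ℝ) : Prop where
  monotoneOn : MonotoneOn ω (Ici 0)
  one_le : ∀ t ≥ 0, 1 ≤ ω t
  map_add_le : ∀ a ≥ 0, ∀ b ≥ 0, ω (a + b) ≤ ω a * ω b

section Mismatch
variable {n : ℕ}

/-- The nodes at which the tangent half-space misjudges a point `y` at distance `d` from `∂Ω` are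
at distance at least of order `√d` and `d` from `y`, so their total weight decays in `d / s²`.
Of the assumed decay exponent, `n + 1` makes the lattice sum converge and `2 (n + 2)` yields the
power `n + 2` of `1 + d / s²`. -/
lemma exists_sum_mismatch_le (η : Euc n → ℂ) {ω : ℝ → ℝ} (hω : IsGrowthRate ω) {A : ℝ}
    (hA : 0 < A) (hηω : ∀ z, ‖η z‖ * ω ‖z‖ ≤ A * ((1 + ‖z‖) ^ (n + 1 + 2 * (n + 2)))⁻¹)
    {s₀ : ℝ} {Cg : ℝ} (hCg : 1 ≤ Cg) :
    ∃ C > (0 : ℝ), ∀ τ : ℝ, 0 < τ → τ ≤ 1 → ∀ s > 0, s ≤ s₀ →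
      ∀ (y : Euc n) (S : Finset (Fin n → ℤ)) (d : ℝ), 0 ≤ d →
      (∀ m ∈ S, d ≤ 2 * ‖y - gridPoint (s * τ) m‖ ∧ d ≤ Cg * ‖y - gridPoint (s * τ) m‖ ^ 2) →
      (∑ m ∈ S, τ ^ n * ‖η (s⁻¹ • (y - gridPoint (s * τ) m))‖) * ω (d / (2 * s₀)) ≤
        C * ((1 + d / s ^ 2) ^ (n + 2))⁻¹ := by
  obtain ⟨C₀, hC₀, h₀⟩ := exists_tsum_inv_pow_le n
  refine ⟨A * Cg ^ (n + 2) * C₀, by positivity, ?_⟩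
  intro τ hτ hτ1 s hs hss y S d hd hS
  set t : Euc n := (s * τ)⁻¹ • y with ht
  set z : (Fin n → ℤ) → Euc n := fun m => τ • (t - gridPoint 1 m) with hz
  have hzeq : ∀ m, s⁻¹ • (y - gridPoint (s * τ) m) = z m := by
    intro m
    rw [hz, ht, gridPoint_eq_smul (s * τ)]
    simp only [smul_sub, smul_smul]
    congr 2 <;> field_simp
  have hdist : ∀ m, ‖y - gridPoint (s * τ) m‖ = s * ‖z m‖ := by
    intro m
    rw [← hzeq, norm_smul, Real.norm_of_nonneg (by positivity), mul_inv_cancel_left₀ hs.ne']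
  simp only [hzeq]
  simp only [hdist] at hS
  obtain ⟨hw, hwC⟩ := h₀ τ hτ hτ1 t
  have hterm : ∀ m ∈ S, τ ^ n * ‖η (z m)‖ * ω (d / (2 * s₀)) ≤
      A * Cg ^ (n + 2) * ((1 + d / s ^ 2) ^ (n + 2))⁻¹ *
        (τ ^ n * ((1 + ‖z m‖) ^ (n + 1))⁻¹) := by
    intro m hm
    obtain ⟨h1, h2⟩ := hS m hm
    have h3 : ω (d / (2 * s₀)) ≤ ω ‖z m‖ := by
      have hs0 : 0 < s₀ := hs.trans_le hss
      refine hω.monotoneOn (mem_Ici.2 (by positivity)) (mem_Ici.2 (norm_nonneg _)) ?_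
      rw [div_le_iff₀ (by positivity)]
      nlinarith [mul_le_mul_of_nonneg_right hss (norm_nonneg (z m))]
    have h4 : (1 + d / s ^ 2) ≤ Cg * (1 + ‖z m‖) ^ 2 := by
      have : d / s ^ 2 ≤ Cg * ‖z m‖ ^ 2 := by
        rw [div_le_iff₀ (by positivity)]
        linarith [h2, mul_pow s ‖z m‖ 2]
      nlinarith [norm_nonneg (z m), mul_nonneg (zero_le_one.trans hCg) (norm_nonneg (z m))]
    have h5 : ((1 + ‖z m‖) ^ (2 * (n + 2)))⁻¹ ≤
        Cg ^ (n + 2) * ((1 + d / s ^ 2) ^ (n + 2))⁻¹ := by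
      rw [inv_le_iff_one_le_mul₀ (by positivity), mul_right_comm, ← div_eq_mul_inv,
        le_div_iff₀ (by positivity), one_mul, pow_mul, ← mul_pow]
      exact pow_le_pow_left₀ (by positivity) h4 _
    calc τ ^ n * ‖η (z m)‖ * ω (d / (2 * s₀)) ≤ τ ^ n * (‖η (z m)‖ * ω ‖z m‖) := by
          rw [mul_assoc]; gcongr
      _ ≤ τ ^ n * (A * ((1 + ‖z m‖) ^ (n + 1 + 2 * (n + 2)))⁻¹) :=
          mul_le_mul_of_nonneg_left (hηω _) (by positivity)
      _ = τ ^ n * A * ((1 + ‖z m‖) ^ (n + 1))⁻¹ * ((1 + ‖z m‖) ^ (2 * (n + 2)))⁻¹ := by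
          rw [pow_add, mul_inv]; ring
      _ ≤ τ ^ n * A * ((1 + ‖z m‖) ^ (n + 1))⁻¹ *
          (Cg ^ (n + 2) * ((1 + d / s ^ 2) ^ (n + 2))⁻¹) := by gcongr
      _ = _ := by ring
  rw [Finset.sum_mul]
  refine (Finset.sum_le_sum hterm).trans ?_
  rw [← Finset.mul_sum]
  calc _ ≤ A * Cg ^ (n + 2) * ((1 + d / s ^ 2) ^ (n + 2))⁻¹ * C₀ := by
        gcongr
        exact (hw.sum_le_tsum _ fun m _ => by positivity).trans hwC
    _ = _ := by ring

end Mismatch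

/-! ### Norms, nodes and absolute convergence -/

section Norms
variable {n : ℕ}

lemma sobolevSupNorm_univ_ne_top {N : ℕ} {F : Euc n → ℂ} (hF : ContDiff ℝ N F)
    (hc : HasCompactSupport F) : sobolevSupNorm N univ F ≠ ⊤ := by
  have h1 : ∀ k : ℕ, ∃ C : ℝ, k ≤ N → ∀ x, ‖iteratedFDeriv ℝ k F x‖ ≤ C := by
    intro k
    by_cases hk : k ≤ N
    · obtain ⟨C, hC⟩ := (hF.continuous_iteratedFDeriv
        (by exact_mod_cast hk)).bounded_above_of_compact_support (hc.iteratedFDeriv k)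
      exact ⟨C, fun _ => hC⟩
    · exact ⟨0, fun h => absurd h hk⟩
  choose C hC using h1
  refine ne_top_of_le_ne_top (ENNReal.sum_ne_top.2 fun k (_ : k ∈ Finset.range (N + 1)) =>
    ENNReal.ofReal_ne_top (r := C k)) ?_
  refine iSup₂_le fun k hk => iSup₂_le fun x _ => ?_
  rw [← ofReal_norm]
  refine (ENNReal.ofReal_le_ofReal (hC k hk x)).trans ?_
  exact Finset.single_le_sum (f := fun k => ENNReal.ofReal (C k)) (fun _ _ => zero_le)
    (Finset.mem_range.2 (by omega))

lemma sobolevSupNorm_le_of_eqOn {N : ℕ} {Ω : Set (Euc n)} (hΩ : IsOpen Ω) {f F : Euc n → ℂ}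
    (h : EqOn F f Ω) : sobolevSupNorm N Ω f ≤ sobolevSupNorm N univ F := by
  refine iSup₂_le fun k hk => iSup₂_le fun x hx => ?_
  have : f =ᶠ[𝓝 x] F := by
    filter_upwards [hΩ.mem_nhds hx] with y hy using (h hy).symm
  rw [(Filter.EventuallyEq.iteratedFDeriv (𝕜 := ℝ) this k).eq_of_nhds]
  exact le_iSup₂_of_le k hk (le_iSup₂_of_le x (mem_univ x) le_rfl)

lemma finite_nodes {Ω : Set (Euc n)} (hb : Bornology.IsBounded Ω) (hne : Ω.Nonempty) {h : ℝ}
    (hh : 0 < h) (D r : ℝ) : (nodes Ω h D r).Finite := by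
  obtain ⟨R, hR⟩ := hb.subset_ball (0 : Euc n)
  set k : ℤ := ⌈(R + (r * (h * √D) + 1)) / h⌉
  refine (Set.finite_Icc (fun _ : Fin n => -k) (fun _ => k)).subset fun m hm => ?_
  have hm' : infDist (gridPoint h m) Ω < r * (h * √D) + 1 := by
    have : infDist (gridPoint h m) Ω ≤ r * (h * √D) := hm
    linarith
  obtain ⟨q, hq, hqd⟩ := (infDist_lt_iff hne).1 hm'
  have h1 := hR hq
  rw [mem_ball] at h1
  have h2 : ‖gridPoint h m‖ ≤ R + (r * (h * √D) + 1) := by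
    rw [← dist_zero_right]; linarith [dist_triangle (gridPoint h m) q 0]
  have h3 : ∀ i, |(m i : ℝ)| ≤ k := by
    intro i
    have h4 : ‖(gridPoint h m) i‖ ≤ ‖gridPoint h m‖ := PiLp.norm_apply_le _ i
    have h5 : (gridPoint h m) i = h * (m i : ℝ) := rfl
    rw [h5, norm_mul, Real.norm_of_nonneg hh.le, Real.norm_eq_abs] at h4
    refine le_trans ?_ (Int.le_ceil _)
    rw [le_div_iff₀ hh]
    linarith
  have h6 : ∀ i, -k ≤ m i ∧ m i ≤ k := fun i => by
    have := abs_le.1 (h3 i); exact_mod_cast this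
  exact ⟨fun i => (h6 i).1, fun i => (h6 i).2⟩

end Norms

section Potential
variable {n : ℕ} {Ω : Set (Euc n)} {lam : ℂ}

/-- The kernel bound used for the points `x` of the evaluation set: the dyadic singularity plus a
growth measured in the distance from `∂Ω`, at the scale `s₀`. -/
def IsKernelBound (lam : ℂ) (Ω : Set (Euc n)) (ω : ℝ → ℝ) (s₀ : ℝ) (B : ℝ≥0) (x : Euc n) : Prop :=
  ∀ y, ‖fundSol lam (x - y)‖ₑ ≤
    B * (dyadicKernel n (x - y) + ENNReal.ofReal (ω (infDist y (frontier Ω) / (2 * s₀))))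

lemma IsKernelBound.enorm_le {ω : ℝ → ℝ} {s₀ : ℝ} {B : ℝ≥0} {x : Euc n} (hs₀ : 0 < s₀)
    (hω : IsGrowthRate ω) (h : IsKernelBound lam Ω ω s₀ B x) (y : Euc n) :
    ‖fundSol lam (x - y)‖ₑ ≤ B * ((dyadicKernel n (x - y) + 1) *
      ENNReal.ofReal (ω (infDist y (frontier Ω) / (2 * s₀)))) := by
  refine (h y).trans ?_
  rw [add_mul, one_mul]
  gcongr
  refine le_mul_of_one_le_right' (ENNReal.one_le_ofReal.2 (hω.one_le _ ?_))
  have : 0 ≤ infDist y (frontier Ω) := infDist_nonneg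
  positivity

lemma aestronglyMeasurable_fundSol_sub (lam : ℂ) (x : Euc n) (μ : Measure (Euc n)) :
    AEStronglyMeasurable (fun y => fundSol lam (x - y)) μ :=
  ((measurable_fundSol lam).comp
    (by fun_prop : Measurable fun y : Euc n => x - y)).aestronglyMeasurable

/-- The integrands of the cubature weights are integrable over the whole space: by the triangle
inequality the decay of `η` about `p` is decay in the distance from `∂Ω`, so the potential estimate
at scale `1` applies. -/
lemma integrable_fundSol_mul_comp_smul (hn : 1 ≤ n) (hΩ : IsOpen Ω)
    (hb : Bornology.IsBounded Ω) (hC2 : HasC2Boundary Ω) (hne : (frontier Ω).Nonempty)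
    {η : Euc n → ℂ} (hηc : Continuous η) {ω : ℝ → ℝ} (hω : IsGrowthRate ω) {A : ℝ} (hA : 0 < A)
    (hηω : ∀ z, ‖η z‖ * ω ‖z‖ ≤ A * ((1 + ‖z‖) ^ (n + 1 + 2 * (n + 2)))⁻¹)
    {s s₀ : ℝ} (hs : 0 < s) (hss : s ≤ s₀) (hs1 : s ≤ 1) {B : ℝ≥0} {x : Euc n}
    (hx : IsKernelBound lam Ω ω s₀ B x) (p : Euc n) :
    Integrable fun y => fundSol lam (x - y) * η (s⁻¹ • (y - p)) := by
  obtain ⟨C, hC⟩ := exists_lintegral_decay_le hn hΩ hb hC2 hne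
  have hs0 : 0 < s₀ := hs.trans_le hss
  refine ⟨(aestronglyMeasurable_fundSol_sub lam x _).mul
    (hηc.comp (by fun_prop)).aestronglyMeasurable, ?_⟩
  set dp := infDist p (frontier Ω)
  have hdp : 0 ≤ dp := infDist_nonneg
  set a := ω (dp / (2 * s₀)) * A * (1 + dp) ^ (n + 2)
  have ha1 : 1 ≤ ω (dp / (2 * s₀)) := hω.one_le _ (by positivity)
  have hpt : ∀ y, ‖fundSol lam (x - y) * η (s⁻¹ • (y - p))‖ₑ ≤
      B * ENNReal.ofReal a * ((dyadicKernel n (x - y) + 1) *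
        ENNReal.ofReal (((1 + infDist y (frontier Ω) / 1 ^ 2) ^ (n + 2))⁻¹)) := by
    intro y
    set d := infDist y (frontier Ω)
    have hd : 0 ≤ d := infDist_nonneg
    set z := s⁻¹ • (y - p) with hz
    have hyp : ‖y - p‖ = s * ‖z‖ := by
      rw [hz, norm_smul, Real.norm_of_nonneg (by positivity), mul_inv_cancel_left₀ hs.ne']
    have hdd : d ≤ dp + s * ‖z‖ := by
      rw [← hyp, ← dist_eq_norm]; exact infDist_le_infDist_add_dist
    have h1 : ω (d / (2 * s₀)) ≤ ω (dp / (2 * s₀)) * ω ‖z‖ := by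
      refine le_trans ?_ (hω.map_add_le _ (by positivity) _ (norm_nonneg z))
      refine hω.monotoneOn (mem_Ici.2 (by positivity)) (mem_Ici.2 (by positivity)) ?_
      rw [div_add' _ _ _ (by positivity)]
      gcongr
      nlinarith [norm_nonneg z, mul_le_mul_of_nonneg_right hss (norm_nonneg z)]
    have h2 : ((1 + ‖z‖) ^ (n + 1 + 2 * (n + 2)))⁻¹ ≤
        (1 + dp) ^ (n + 2) * ((1 + d) ^ (n + 2))⁻¹ := by
      have h3 : 1 + d ≤ (1 + dp) * (1 + ‖z‖) := by
        nlinarith [norm_nonneg z, mul_le_mul_of_nonneg_right hs1 (norm_nonneg z),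
          mul_nonneg hdp (norm_nonneg z)]
      have h4 : ((1 + ‖z‖) ^ (n + 1 + 2 * (n + 2)))⁻¹ ≤ ((1 + ‖z‖) ^ (n + 2))⁻¹ := by
        refine inv_anti₀ (by positivity) (pow_le_pow_right₀ ?_ (by omega))
        linarith [norm_nonneg z]
      refine h4.trans ?_
      rw [inv_le_iff_one_le_mul₀ (by positivity), mul_right_comm, ← div_eq_mul_inv,
        le_div_iff₀ (by positivity), one_mul, ← mul_pow]
      exact pow_le_pow_left₀ (by positivity) h3 _
    have h5 : ω (d / (2 * s₀)) * ‖η z‖ ≤ a * ((1 + d) ^ (n + 2))⁻¹ := by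
      calc _ ≤ ω (dp / (2 * s₀)) * ω ‖z‖ * ‖η z‖ := by gcongr
        _ = ω (dp / (2 * s₀)) * (‖η z‖ * ω ‖z‖) := by ring
        _ ≤ ω (dp / (2 * s₀)) * (A * ((1 + dp) ^ (n + 2) * ((1 + d) ^ (n + 2))⁻¹)) := by
          refine mul_le_mul_of_nonneg_left ((hηω z).trans ?_) (by linarith)
          gcongr
        _ = _ := by ring
    have hω0 : 0 ≤ ω (d / (2 * s₀)) := zero_le_one.trans (hω.one_le _ (by positivity))
    rw [enorm_mul, ← ofReal_norm (η z)]
    refine (mul_le_mul_left (hx.enorm_le hs0 hω y) _).trans ?_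
    rw [mul_assoc, mul_assoc, mul_assoc, ← ENNReal.ofReal_mul hω0]
    refine mul_le_mul_right ?_ _
    rw [mul_left_comm, ← ENNReal.ofReal_mul (by positivity), one_pow, div_one]
    exact mul_le_mul_right (ENNReal.ofReal_le_ofReal h5) _
  refine (lintegral_mono hpt).trans_lt ?_
  rw [lintegral_const_mul' _ _ (by finiteness)]
  refine ENNReal.mul_lt_top (by finiteness) ((hC 1 one_pos le_rfl x).trans_lt (by finiteness))

lemma setLIntegral_enorm_fundSol_le {ω : ℝ → ℝ} (hω : IsGrowthRate ω) {s₀ T : ℝ} (hs₀ : 0 < s₀)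
    (hT : ∀ y ∈ Ω, infDist y (frontier Ω) ≤ T) {B C : ℝ≥0} {x : Euc n} (hΩ : MeasurableSet Ω)
    (hC : ∫⁻ y in Ω, (dyadicKernel n (x - y) + 1) ≤ C) (hx : IsKernelBound lam Ω ω s₀ B x) :
    ∫⁻ y in Ω, ‖fundSol lam (x - y)‖ₑ ≤ B * (C * ENNReal.ofReal (ω (T / (2 * s₀)))) := by
  calc _ ≤ ∫⁻ y in Ω, B * ((dyadicKernel n (x - y) + 1) * ENNReal.ofReal (ω (T / (2 * s₀)))) := by
        refine setLIntegral_mono' hΩ fun y hy => (hx.enorm_le hs₀ hω y).trans ?_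
        have hd : 0 ≤ infDist y (frontier Ω) := infDist_nonneg
        have hd' := hT y hy
        gcongr
        exact hω.monotoneOn (mem_Ici.2 (by positivity))
          (mem_Ici.2 (div_nonneg (hd.trans hd') (by positivity))) (by gcongr)
    _ = B * ((∫⁻ y in Ω, (dyadicKernel n (x - y) + 1)) * ENNReal.ofReal (ω (T / (2 * s₀)))) := by
        rw [lintegral_const_mul' _ _ (by finiteness), lintegral_mul_const' _ _ (by finiteness)]
    _ ≤ _ := by gcongr

end Potential

/-! ### The error integral -/

section Error
variable {n : ℕ} {Ω : Set (Euc n)} {lam : ℂ}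

/-- The pointwise density error of the cubature splits into the quasi-interpolation error inside
`Ω` and the contribution of the nodes whose half-space disagrees with `Ω` at `y`. -/
lemma norm_sum_indicator_sub_le {ι : Type*} (S : Finset ι) (T : ι → Set (Euc n)) (w : ι → Euc n → ℂ)
    (F : Euc n → ℂ) (y : Euc n) {e M : ℝ} (b : ι → ℝ) (he : y ∈ Ω → ‖∑ m ∈ S, w m y - F y‖ ≤ e)
    (hw : ∀ m ∈ S, ‖w m y‖ ≤ M * b m) [DecidablePred fun m => ¬ (y ∈ T m ↔ y ∈ Ω)] :
    ‖∑ m ∈ S, (T m).indicator (w m) y - Ω.indicator F y‖ ≤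
      Ω.indicator (fun _ => e) y + M * ∑ m ∈ S with ¬ (y ∈ T m ↔ y ∈ Ω), b m := by
  have h1 : ∑ m ∈ S, (T m).indicator (w m) y - Ω.indicator F y =
      Ω.indicator (fun y => ∑ m ∈ S, w m y - F y) y +
        ∑ m ∈ S, ((T m).indicator (w m) y - Ω.indicator (w m) y) := by
    rw [Finset.sum_sub_distrib]
    by_cases hy : y ∈ Ω
    · simp only [indicator_of_mem hy]; ring
    · simp only [indicator_of_notMem hy]; simp
  rw [h1]
  refine (norm_add_le _ _).trans (add_le_add ?_ ?_)
  · by_cases hy : y ∈ Ω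
    · simp only [indicator_of_mem hy]; exact he hy
    · simp only [indicator_of_notMem hy]; simp
  · rw [Finset.mul_sum, Finset.sum_filter]
    refine (norm_sum_le _ _).trans (Finset.sum_le_sum fun m hm => ?_)
    by_cases hT : y ∈ T m <;> by_cases hy : y ∈ Ω <;>
      simp [hT, hy, hw m hm]

/-- The cubature error as a single integral of the kernel against the density error. -/
lemma cubature_sub_volPotential_eq {η F f : Euc n → ℂ} {h D r : ℝ} {P ν : (Fin n → ℤ) → Euc n}
    {x : Euc n} (hfin : (nodes Ω h D r).Finite) (hΩ : MeasurableSet Ω) (hfF : EqOn F f Ω)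
    (hi : ∀ m, Integrable fun y => fundSol lam (x - y) * scaledShift η h D m y)
    (hiF : IntegrableOn (fun y => fundSol lam (x - y) * F y) Ω) :
    cubature lam Ω η F h D r P ν x - volPotential lam Ω f x =
      ∫ y, fundSol lam (x - y) * (∑ m ∈ hfin.toFinset, (halfSpace (P m) (ν m)).indicator
        (fun y => (D ^ (-(n : ℝ) / 2) : ℝ) • (F (gridPoint h m) * scaledShift η h D m y)) y -
          Ω.indicator F y) := by
  have hT : ∀ m, MeasurableSet (halfSpace (P m) (ν m)) := fun m =>
    (isOpen_lt continuous_const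
      (by fun_prop : Continuous fun y : Euc n => ⟪ν m, y - P m⟫)).measurableSet
  have h1 : ∀ m, Integrable fun y => (halfSpace (P m) (ν m)).indicator (fun y =>
      (((D ^ (-(n : ℝ) / 2) : ℝ) : ℂ) * F (gridPoint h m)) *
        (fundSol lam (x - y) * scaledShift η h D m y)) y := fun m =>
    ((hi m).const_mul _).indicator (hT m)
  have h2 : Integrable (Ω.indicator fun y => fundSol lam (x - y) * F y) :=
    hiF.integrable_indicator hΩ
  have h3 : ∀ y, fundSol lam (x - y) * (∑ m ∈ hfin.toFinset, (halfSpace (P m) (ν m)).indicator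
        (fun y => (D ^ (-(n : ℝ) / 2) : ℝ) • (F (gridPoint h m) * scaledShift η h D m y)) y -
          Ω.indicator F y) =
      ∑ m ∈ hfin.toFinset, (halfSpace (P m) (ν m)).indicator (fun y =>
      (((D ^ (-(n : ℝ) / 2) : ℝ) : ℂ) * F (gridPoint h m)) *
        (fundSol lam (x - y) * scaledShift η h D m y)) y -
          Ω.indicator (fun y => fundSol lam (x - y) * F y) y := by
    intro y
    rw [mul_sub, Finset.mul_sum]
    congr 1
    · refine Finset.sum_congr rfl fun m _ => ?_
      by_cases hy : y ∈ halfSpace (P m) (ν m)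
      · simp only [indicator_of_mem hy, Complex.real_smul]; ring
      · simp only [indicator_of_notMem hy, mul_zero]
    · by_cases hy : y ∈ Ω
      · simp only [indicator_of_mem hy]
      · simp only [indicator_of_notMem hy, mul_zero]
  simp_rw [h3]
  rw [integral_sub (integrable_finsetSum _ fun m _ => h1 m) h2,
    integral_finsetSum _ fun m _ => h1 m, integral_indicator hΩ, cubature, volPotential,
    finsum_mem_eq_finite_toFinset_sum _ hfin, Finset.mul_sum]
  congr 1
  · refine Finset.sum_congr rfl fun m _ => ?_
    rw [integral_indicator (hT m), integral_const_mul, mul_assoc]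
  · exact setIntegral_congr_fun hΩ fun y hy => by simp only [hfF hy]

/-- Integrating the pointwise density error against the kernel. -/
lemma norm_integral_fundSol_mul_le (hΩ : MeasurableSet Ω) {ω : ℝ → ℝ} (hω : IsGrowthRate ω)
    {s₀ T s : ℝ} (hs₀ : 0 < s₀) (hs : 0 < s) (hT0 : 0 ≤ T)
    (hT : ∀ y ∈ Ω, infDist y (frontier Ω) ≤ T) {B C₁ C₂ : ℝ≥0} {x : Euc n}
    (hC₁ : ∫⁻ y in Ω, (dyadicKernel n (x - y) + 1) ≤ C₁)
    (hC₂ : ∫⁻ y, (dyadicKernel n (x - y) + 1) *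
      ENNReal.ofReal (((1 + infDist y (frontier Ω) / s ^ 2) ^ (n + 2))⁻¹) ≤
        C₂ * ENNReal.ofReal (s ^ 2))
    (hx : IsKernelBound lam Ω ω s₀ B x) {E : Euc n → ℂ} {g : Euc n → ℝ} {e M Q : ℝ} (he : 0 ≤ e)
    (hM : 0 ≤ M) (hQ : 0 ≤ Q)
    (hE : ∀ y, ‖E y‖ ≤ Ω.indicator (fun _ => e) y + M * g y)
    (hg : ∀ y, g y * ω (infDist y (frontier Ω) / (2 * s₀)) ≤
      Q * ((1 + infDist y (frontier Ω) / s ^ 2) ^ (n + 2))⁻¹) :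
    ‖∫ y, fundSol lam (x - y) * E y‖ ≤
      B * (C₁ * ω (T / (2 * s₀)) * e + C₂ * M * Q * s ^ 2) := by
  have hωT : 1 ≤ ω (T / (2 * s₀)) := hω.one_le _ (by positivity)
  rw [← ENNReal.ofReal_le_ofReal_iff (by positivity), ofReal_norm]
  have hm : Measurable fun y => dyadicKernel n (x - y) + 1 :=
    ((measurable_dyadicKernel n).comp (by fun_prop)).add_const 1
  have hpt : ∀ y, ‖fundSol lam (x - y) * E y‖ₑ ≤
      B * (Ω.indicator (fun y => (dyadicKernel n (x - y) + 1) *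
          ENNReal.ofReal (ω (T / (2 * s₀)) * e)) y +
        (dyadicKernel n (x - y) + 1) *
          ENNReal.ofReal (((1 + infDist y (frontier Ω) / s ^ 2) ^ (n + 2))⁻¹) *
            ENNReal.ofReal (M * Q)) := by
    intro y
    set d := infDist y (frontier Ω) with hd_def
    have hd : 0 ≤ d := infDist_nonneg
    have hω0 : 0 ≤ ω (d / (2 * s₀)) := zero_le_one.trans (hω.one_le _ (by positivity))
    rw [enorm_mul, ← ofReal_norm (E y)]
    refine (mul_le_mul' (hx.enorm_le hs₀ hω y) le_rfl).trans ?_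
    rw [mul_assoc, mul_assoc, ← ENNReal.ofReal_mul hω0]
    refine mul_le_mul_right ?_ _
    have h1 : ω (d / (2 * s₀)) * ‖E y‖ ≤ Ω.indicator (fun _ => ω (T / (2 * s₀)) * e) y +
        ((1 + d / s ^ 2) ^ (n + 2))⁻¹ * (M * Q) := by
      calc _ ≤ ω (d / (2 * s₀)) * (Ω.indicator (fun _ => e) y + M * g y) := by
            gcongr; exact hE y
        _ = ω (d / (2 * s₀)) * Ω.indicator (fun _ => e) y + M * (g y * ω (d / (2 * s₀))) := by ring
        _ ≤ Ω.indicator (fun _ => ω (T / (2 * s₀)) * e) y +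
            M * (Q * ((1 + d / s ^ 2) ^ (n + 2))⁻¹) := by
          refine add_le_add ?_ (mul_le_mul_of_nonneg_left (hg y) hM)
          by_cases hy : y ∈ Ω
          · simp only [indicator_of_mem hy]
            refine mul_le_mul_of_nonneg_right (hω.monotoneOn (mem_Ici.2 (by positivity))
              (mem_Ici.2 (by positivity)) ?_) he
            have := hT y hy
            gcongr
          · simp only [indicator_of_notMem hy, mul_zero, le_refl]
        _ = _ := by ring
    refine (mul_le_mul_right (ENNReal.ofReal_le_ofReal h1) _).trans (le_of_eq ?_)
    rw [ENNReal.ofReal_add (indicator_nonneg (fun _ _ => by positivity) _) (by positivity),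
      mul_add, ENNReal.ofReal_mul (by positivity), mul_assoc]
    congr 1
    by_cases hy : y ∈ Ω
    · simp only [indicator_of_mem hy]
    · simp only [indicator_of_notMem hy, ENNReal.ofReal_zero, mul_zero]
  refine (enorm_integral_le_lintegral_enorm _).trans ((lintegral_mono hpt).trans ?_)
  rw [lintegral_const_mul' _ _ (by finiteness),
    lintegral_add_left ((hm.mul_const _).indicator hΩ), lintegral_indicator hΩ,
    lintegral_mul_const' _ _ (by finiteness), lintegral_mul_const' _ _ (by finiteness)]
  calc _ ≤ (B : ℝ≥0∞) * (C₁ * ENNReal.ofReal (ω (T / (2 * s₀)) * e) +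
        C₂ * ENNReal.ofReal (s ^ 2) * ENNReal.ofReal (M * Q)) := by gcongr
    _ = _ := by
      rw [ENNReal.ofReal_mul B.coe_nonneg, ENNReal.ofReal_add (by positivity) (by positivity),
        ENNReal.ofReal_coe_nnreal, mul_assoc (C₁ : ℝ), ENNReal.ofReal_mul C₁.coe_nonneg,
        ENNReal.ofReal_coe_nnreal, mul_assoc (C₂ : ℝ), mul_assoc (C₂ : ℝ),
        ENNReal.ofReal_mul C₂.coe_nonneg, ENNReal.ofReal_coe_nnreal,
        ENNReal.ofReal_mul (p := M * Q) (by positivity)]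
      ring

end Error

/-- The cubature estimate under abstract growth conditions on the kernel and the generating
function. -/
theorem exists_cubature_error_le {n : ℕ} (hn : 1 ≤ n) (N : ℕ) (hN : 2 ≤ N) (lam : ℂ)
    (Ω : Set (Euc n)) (hΩo : IsOpen Ω) (hΩb : Bornology.IsBounded Ω) (hΩn : Ω.Nonempty)
    (hΩ : HasC2Boundary Ω) (hne : (frontier Ω).Nonempty)
    (η : 𝓢(Euc n, ℂ)) (hη : MomentCondition N η) (X : Set (Euc n)) (CE : ℝ≥0)
    {ω : ℝ → ℝ} (hω : IsGrowthRate ω) {A : ℝ} (hA : 0 < A)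
    (hηω : ∀ z, ‖η z‖ * ω ‖z‖ ≤ A * ((1 + ‖z‖) ^ (n + 1 + 2 * (n + 2)))⁻¹)
    {s₀ : ℝ} (hs₀ : 0 < s₀) (hs₀1 : s₀ ≤ 1) {B : ℝ≥0}
    (hX : ∀ x ∈ X, IsKernelBound lam Ω ω s₀ B x) :
    ∃ c₁ > (0 : ℝ), ∀ ε > (0 : ℝ), ∃ r₀ > (0 : ℝ), ∃ D₀ > (0 : ℝ),
      ∀ r ≥ r₀, ∀ D ≥ D₀, ∀ h > (0 : ℝ), h * √D ≤ s₀ →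
      ∀ f F : Euc n → ℂ, ContDiff ℝ N F → HasCompactSupport F →
        EqOn F f Ω → sobolevSupNorm N univ F ≤ CE * sobolevSupNorm N Ω f →
      ∀ P ν : (Fin n → ℤ) → Euc n, IsNearestBoundaryData Ω h P ν →
      ∀ x ∈ X,
        IntegrableOn (fun y => fundSol lam (x - y) * f y) Ω ∧
        (∀ m ∈ nodes Ω h D r,
          IntegrableOn (fun y => fundSol lam (x - y) * scaledShift η h D m y)
            (halfSpace (P m) (ν m))) ∧
        ‖cubature lam Ω η F h D r P ν x - volPotential lam Ω f x‖ ≤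
          (ε + c₁ * (h * √D) ^ 2) * (sobolevSupNorm N Ω f).toReal := by
  obtain ⟨Cg, hCg, hgeo⟩ := exists_infDist_frontier_le_sq hΩo hΩb hΩ
  obtain ⟨Cq, hCq, hquasi⟩ := exists_norm_quasiInterpolant_sub_le hN η hη
  obtain ⟨Cm, hCm, hmis⟩ := exists_sum_mismatch_le (η := η) hω hA hηω (s₀ := s₀) (Cg := Cg * 4)
    (by linarith)
  obtain ⟨C₁, hC₁⟩ := exists_setLIntegral_domain_le hn hΩo hΩb hΩ hne
  obtain ⟨C₂, hC₂⟩ := exists_lintegral_decay_le hn hΩo hΩb hΩ hne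
  obtain ⟨T, hT0, hT⟩ : ∃ T, 0 ≤ T ∧ ∀ y ∈ Ω, infDist y (frontier Ω) ≤ T := by
    obtain ⟨q, hq⟩ := hne
    obtain ⟨R, hR, hRb⟩ := hΩb.subset_ball_lt 0 q
    exact ⟨R, hR.le, fun y hy => (infDist_le_dist_of_mem hq).trans (mem_ball.1 (hRb hy)).le⟩
  have hωT : 1 ≤ ω (T / (2 * s₀)) := hω.one_le _ (by positivity)
  set a₁ : ℝ := B * (C₁ * ω (T / (2 * s₀)) * Cq) with ha₁
  have ha₁0 : 0 ≤ a₁ := by positivity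
  set a₂ : ℝ := a₁ + B * (C₂ * Cm) with ha₂
  have ha₂0 : 0 ≤ a₂ := by positivity
  refine ⟨CE * a₂ + 1, by positivity, fun ε hε => ?_⟩
  -- `τ ≤ q` and `(1 + r)⁻¹ ≤ q` keep the saturation error `CE a₁ (τ + (1 + r)⁻¹)` below `ε`
  set q : ℝ := ε / (2 * (CE * a₁ + 1)) with hq
  have hq0 : 0 < q := by positivity
  refine ⟨q⁻¹, by positivity, max 1 ((q ^ 2)⁻¹), by positivity, ?_⟩
  intro r hr D hD h hh hhD f F hF hFc hFf hFn P ν hPν x hx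
  have hD1 : 1 ≤ D := (le_max_left _ _).trans hD
  have hDq : (q ^ 2)⁻¹ ≤ D := (le_max_right _ _).trans hD
  have hD0 : 0 < D := by linarith
  set s := h * √D with hs_def
  have hsD : 0 < √D := Real.sqrt_pos.2 hD0
  have hs : 0 < s := by positivity
  have hs1 : s ≤ 1 := hhD.trans hs₀1
  set τ := (√D)⁻¹ with hτ_def
  have hτ : 0 < τ := by positivity
  have hτ1 : τ ≤ 1 := inv_le_one_of_one_le₀ (Real.one_le_sqrt.2 hD1)
  have hτq : τ ≤ q := by
    rw [hτ_def, inv_le_comm₀ hsD hq0]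
    refine Real.le_sqrt_of_sq_le ?_
    rwa [inv_pow]
  have hrq : (1 + r)⁻¹ ≤ q := by
    have : 0 < q⁻¹ := by positivity
    rw [inv_le_comm₀ (by linarith) hq0]; linarith
  have hr0 : 0 < r := lt_of_lt_of_le (by positivity) hr
  have hhτ : s * τ = h := by rw [hs_def, hτ_def]; field_simp
  have hDn : D ^ (-(n : ℝ) / 2) = τ ^ n := by
    rw [hτ_def, Real.sqrt_eq_rpow, ← Real.rpow_neg hD0.le, ← Real.rpow_natCast,
      ← Real.rpow_mul hD0.le]
    congr 1; ring
  have hfin := finite_nodes hΩb hΩn hh D r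
  -- as the restriction of a compactly supported function, `f` has finite norm; so `toReal` is
  -- faithful
  have hFtop := sobolevSupNorm_univ_ne_top hF hFc
  have hftop : sobolevSupNorm N Ω f ≠ ⊤ :=
    ne_top_of_le_ne_top hFtop (sobolevSupNorm_le_of_eqOn hΩo hFf)
  have hTay := isTaylorBound_sobolevSupNorm hN hF hFtop
  set M := (sobolevSupNorm N univ F).toReal
  have hM0 : 0 ≤ M := hTay.nonneg
  have hMf : M ≤ CE * (sobolevSupNorm N Ω f).toReal := by
    have := ENNReal.toReal_mono (by finiteness) hFn
    simpa using this
  have hxB := hX x hx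
  -- absolute convergence
  have hi : ∀ m, Integrable fun y => fundSol lam (x - y) * scaledShift η h D m y := fun m =>
    integrable_fundSol_mul_comp_smul hn hΩo hΩb hΩ hne η.continuous hω hA hηω hs hhD hs1 hxB _
  have hiF : IntegrableOn (fun y => fundSol lam (x - y) * F y) Ω := by
    refine Integrable.mul_bdd (c := M) ?_ hF.continuous.aestronglyMeasurable
      (Eventually.of_forall hTay.norm_le)
    refine ⟨aestronglyMeasurable_fundSol_sub lam x _, ?_⟩
    exact (setLIntegral_enorm_fundSol_le hω hs₀ hT hΩo.measurableSet (hC₁ x) hxB).trans_lt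
      (by finiteness)
  refine ⟨hiF.congr_fun (fun y hy => by simp only [hFf hy]) hΩo.measurableSet,
    fun m _ => (hi m).integrableOn, ?_⟩
  rw [cubature_sub_volPotential_eq hfin hΩo.measurableSet hFf hi hiF]
  classical
  have hmain := norm_integral_fundSol_mul_le (E := fun y => ∑ m ∈ hfin.toFinset,
      (halfSpace (P m) (ν m)).indicator (fun y => (D ^ (-(n : ℝ) / 2) : ℝ) •
        (F (gridPoint h m) * scaledShift η h D m y)) y - Ω.indicator F y)
    (g := fun y => ∑ m ∈ hfin.toFinset with ¬ (y ∈ halfSpace (P m) (ν m) ↔ y ∈ Ω),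
      τ ^ n * ‖scaledShift η h D m y‖)
    (e := Cq * (τ + (1 + r)⁻¹ + s ^ 2) * M) (M := M) (Q := Cm)
    hΩo.measurableSet hω hs₀ hs hT0 hT (hC₁ x) (hC₂ s hs hs1 x) hxB (by positivity) hM0 hCm.le
    (fun y => ?_) (fun y => ?_)
  · refine hmain.trans ?_
    have h1 : B * (C₁ * ω (T / (2 * s₀)) * (Cq * (τ + (1 + r)⁻¹ + s ^ 2) * M) +
        C₂ * M * Cm * s ^ 2) = (a₁ * (τ + (1 + r)⁻¹) + a₂ * s ^ 2) * M := by
      rw [ha₂, ha₁]; ring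
    rw [h1]
    calc _ ≤ (a₁ * (q + q) + a₂ * s ^ 2) * (CE * (sobolevSupNorm N Ω f).toReal) := by gcongr
      _ = (2 * (CE * a₁) * q + CE * a₂ * s ^ 2) * (sobolevSupNorm N Ω f).toReal := by ring
      _ ≤ _ := by
        have h2 : 2 * (CE * a₁) * q ≤ ε := by
          rw [hq, ← mul_div_assoc, div_le_iff₀ (by positivity)]
          nlinarith
        have h3 : 0 ≤ s ^ 2 := sq_nonneg s
        gcongr
        linarith
  · refine norm_sum_indicator_sub_le _ _ _ _ _ _ (fun hy => ?_) fun m _ => ?_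
    · have := hquasi τ hτ hτ1 s hs hs1 r hr0 y hfin.toFinset (fun m hm => ?_) F M hTay
      · rw [hhτ, ← hDn] at this
        exact this
      · rw [hfin.mem_toFinset]
        rw [hhτ, norm_smul, Real.norm_of_nonneg (by positivity), inv_mul_le_iff₀ hs,
          ← dist_eq_norm, dist_comm] at hm
        change infDist _ Ω ≤ r * s
        exact (infDist_le_dist_of_mem hy).trans (by linarith)
    · rw [hDn, norm_smul, norm_mul, Real.norm_of_nonneg (by positivity)]
      have := hTay.norm_le (gridPoint h m)
      calc _ ≤ τ ^ n * (M * ‖scaledShift η h D m y‖) := by gcongr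
        _ = _ := by ring
  · have := hmis τ hτ hτ1 s hs hhD y
      (hfin.toFinset.filter fun m => ¬ (y ∈ halfSpace (P m) (ν m) ↔ y ∈ Ω))
      (infDist y (frontier Ω)) infDist_nonneg (fun m hm => ?_)
    · rw [hhτ] at this
      exact this
    · obtain ⟨hP, hdist, hnor⟩ := hPν m
      have hne' := (Finset.mem_filter.1 hm).2
      have h1 := dist_le_two_mul_of_not_iff hΩo hnor hdist hne'
      have h2 := hgeo (P m) hP (ν m) hnor y hne'
      rw [hhτ, ← dist_eq_norm]
      refine ⟨(infDist_le_dist_of_mem hP).trans h1, h2.trans ?_⟩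
      calc Cg * dist y (P m) ^ 2 ≤ Cg * (2 * dist y (gridPoint h m)) ^ 2 := by gcongr
        _ = _ := by ring

/-! ### Choice of the growth rate -/

lemma IsGrowthRate.one : IsGrowthRate fun _ => 1 :=
  ⟨fun _ _ _ _ _ => le_rfl, fun _ _ => le_rfl, fun _ _ _ _ => by norm_num⟩

lemma IsGrowthRate.one_add : IsGrowthRate fun t => 1 + t :=
  ⟨fun _ _ _ _ h => by simpa using h, fun t ht => by simpa using ht,
    fun a ha b hb => by nlinarith [mul_nonneg ha hb]⟩

lemma IsGrowthRate.exp {c : ℝ} (hc : 0 ≤ c) : IsGrowthRate fun t => Real.exp (c * t) :=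
  ⟨fun _ _ _ _ h => Real.exp_le_exp.2 (mul_le_mul_of_nonneg_left h hc),
    fun t ht => Real.one_le_exp (by positivity),
    fun a _ b _ => by rw [mul_add, Real.exp_add]⟩

/-- Transfer of a growth bound in `‖x - y‖` to one in the distance of `y` from `∂Ω`, for `x` in
a bounded set. -/
lemma exists_norm_sub_le_add_infDist {n : ℕ} {Ω X : Set (Euc n)} (hΩb : Bornology.IsBounded Ω)
    (hne : (frontier Ω).Nonempty) (hX : Bornology.IsBounded X) :
    ∃ R ≥ (0 : ℝ), ∀ x ∈ X, ∀ y, ‖x - y‖ ≤ R + infDist y (frontier Ω) := by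
  have hcpt : IsCompact (frontier Ω) :=
    Metric.isCompact_of_isClosed_isBounded isClosed_frontier
      (hΩb.closure.subset frontier_subset_closure)
  obtain ⟨R₁, hR₁, h₁⟩ := hcpt.isBounded.subset_ball_lt 0 (0 : Euc n)
  obtain ⟨R₂, hR₂, h₂⟩ := hX.subset_ball_lt 0 (0 : Euc n)
  refine ⟨R₁ + R₂, by positivity, fun x hx y => ?_⟩
  obtain ⟨q, hq, hqd⟩ := hcpt.exists_infDist_eq_dist hne y
  have e1 := mem_ball.1 (h₁ hq)
  have e2 := mem_ball.1 (h₂ hx)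
  rw [← dist_eq_norm, hqd]
  have e3 := dist_triangle x 0 y
  have e4 := dist_triangle 0 q y
  rw [dist_comm 0 q, dist_comm q y] at e4
  linarith

lemma isKernelBound_of_growth {n : ℕ} {Ω : Set (Euc n)} {lam : ℂ} {ω G : ℝ → ℝ} {s₀ : ℝ}
    {B : ℝ≥0} {L : ℝ≥0} (hL : 1 ≤ L) {x : Euc n}
    (hB : ∀ z : Euc n, ‖fundSol lam z‖ₑ ≤ B * (dyadicKernel n z + ENNReal.ofReal (G ‖z‖)))
    (hG : ∀ y, G ‖x - y‖ ≤ L * ω (infDist y (frontier Ω) / (2 * s₀))) :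
    IsKernelBound lam Ω ω s₀ (B * L) x := by
  intro y
  refine (hB (x - y)).trans ?_
  rw [ENNReal.coe_mul, mul_assoc]
  gcongr
  rw [mul_add]
  gcongr
  · exact le_mul_of_one_le_left' (by exact_mod_cast hL)
  · refine (ENNReal.ofReal_le_ofReal (hG y)).trans (le_of_eq ?_)
    rw [ENNReal.ofReal_mul L.coe_nonneg, ENNReal.ofReal_coe_nnreal]

lemma exists_exp_decay_le_inv_pow {c : ℝ} (hc : 0 < c) (k : ℕ) :
    ∃ A > (0 : ℝ), ∀ t ≥ 0, Real.exp (-(c * t)) ≤ A * ((1 + t) ^ k)⁻¹ := by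
  refine ⟨Real.exp c * (k.factorial / c ^ k), by positivity, fun t ht => ?_⟩
  have h1 := Real.pow_div_factorial_le_exp (c * (1 + t)) (by positivity) k
  rw [div_le_iff₀ (by positivity), mul_pow, mul_add, mul_one, Real.exp_add] at h1
  rw [Real.exp_neg, ← div_eq_mul_inv, inv_eq_one_div,
    div_le_div_iff₀ (by positivity) (by positivity)]
  calc 1 * (1 + t) ^ k = (c ^ k * (1 + t) ^ k) / c ^ k := by field_simp
    _ ≤ (Real.exp c * Real.exp (c * t) * k.factorial) / c ^ k := by gcongr
    _ = _ := by ring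

/-- For every admissible `lam`, `η` and `X`, a growth rate compatible with both the kernel and the
generating function exists at a sufficiently small scale. -/
lemma exists_growthRate {n : ℕ} (lam : ℂ) (hlam : lam = 0 ∨ lam ∈ Complex.slitPlane)
    (hn : 2 ≤ n ∨ (n = 1 ∧ lam ≠ 0)) (Ω : Set (Euc n)) (hΩb : Bornology.IsBounded Ω)
    (hne : (frontier Ω).Nonempty) (η : 𝓢(Euc n, ℂ))
    (hconv : 0 ≤ lam.re ∨ ∃ A : ℝ, ∃ σ > (0 : ℝ), ∀ x, ‖η x‖ ≤ A * Real.exp (-σ * ‖x‖))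
    (X : Set (Euc n))
    (hX : Bornology.IsBounded X ∨ (0 ≤ lam.re ∧ ¬ (n = 2 ∧ lam = 0))) (k : ℕ) :
    ∃ ω : ℝ → ℝ, IsGrowthRate ω ∧ (∃ A > (0 : ℝ), ∀ z, ‖η z‖ * ω ‖z‖ ≤ A * ((1 + ‖z‖) ^ k)⁻¹) ∧
      ∃ s₀ > (0 : ℝ), s₀ ≤ 1 ∧ ∃ B : ℝ≥0, ∀ x ∈ X, IsKernelBound lam Ω ω s₀ B x := by
  have hn1 : 1 ≤ n := by omega
  by_cases h2 : n = 2 ∧ lam = 0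
  · -- logarithmic kernel
    obtain ⟨rfl, rfl⟩ := h2
    have hXb : Bornology.IsBounded X := hX.resolve_right fun h => h.2 ⟨rfl, rfl⟩
    obtain ⟨C, hC, hk⟩ := exists_norm_fundSol_zero_two_le
    obtain ⟨B, hB⟩ := exists_enorm_le_dyadicKernel_add hn1 (k := fundSol 0) (G := fun t => 1 + t)
      (fun _ _ _ _ h => by simpa using h) (fun t ht => by simpa using ht) hC hk
    obtain ⟨R, hR, hRX⟩ := exists_norm_sub_le_add_infDist hΩb hne hXb
    obtain ⟨A, hA, hηA⟩ := η.exists_norm_le_inv_pow (k + 1) 0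
    simp only [norm_iteratedFDeriv_zero] at hηA
    refine ⟨fun t => 1 + t, IsGrowthRate.one_add, ⟨A, hA, fun z => ?_⟩, 1 / 2, by norm_num,
      by norm_num, B * (1 + R).toNNReal,
      fun x hx => isKernelBound_of_growth (G := fun t => 1 + t) ?_ hB fun y => ?_⟩
    · calc _ ≤ A * ((1 + ‖z‖) ^ (k + 1))⁻¹ * (1 + ‖z‖) := by gcongr; exact hηA z
        _ = _ := by rw [pow_succ]; field_simp
    · rw [← Real.toNNReal_one]; exact Real.toNNReal_mono (by linarith)
    · rw [Real.coe_toNNReal _ (by linarith)]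
      have hd : 0 ≤ infDist y (frontier Ω) := infDist_nonneg
      have := hRX x hx y
      norm_num
      nlinarith [mul_nonneg hR hd]
  rcases le_or_gt 0 lam.re with hre | hre
  · -- bounded kernel away from the origin
    obtain ⟨C, hC, hk⟩ : ∃ C > (0 : ℝ), ∀ z : Euc n,
        ‖fundSol lam z‖ ≤ C * max 1 (‖z‖ ^ (-singExp n)) * (fun _ : ℝ => (1 : ℝ)) ‖z‖ := by
      rcases hlam with rfl | hl
      · obtain ⟨C, hC, hk⟩ := exists_norm_fundSol_zero_le (n := n) (by
          rcases hn with h | h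
          · exact lt_of_le_of_ne h fun h' => h2 ⟨h'.symm, rfl⟩
          · exact absurd rfl h.2)
        exact ⟨C, hC, fun z => by simpa using hk z⟩
      · obtain ⟨C, hC, hk⟩ := exists_norm_fundSol_le_exp hn1 hl
        refine ⟨C, hC, fun z => ?_⟩
        have := hk z
        rwa [max_eq_left (show -lam.re ≤ 0 by linarith), zero_mul, Real.exp_zero] at this
    obtain ⟨B, hB⟩ := exists_enorm_le_dyadicKernel_add hn1 (k := fundSol lam) (G := fun _ => 1)
      (fun _ _ _ _ _ => le_rfl) (fun _ _ => le_rfl) hC hk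
    obtain ⟨A, hA, hηA⟩ := η.exists_norm_le_inv_pow k 0
    simp only [norm_iteratedFDeriv_zero] at hηA
    refine ⟨fun _ => 1, IsGrowthRate.one, ⟨A, hA, fun z => ?_⟩, 1, one_pos, le_rfl, B * 1,
      fun x _ => isKernelBound_of_growth (G := fun _ => 1) le_rfl hB fun y => by simp⟩
    rw [mul_one]; exact hηA z
  · -- exponentially growing kernel
    have hl : lam ∈ Complex.slitPlane := hlam.resolve_left fun h => by simp [h] at hre
    have hXb : Bornology.IsBounded X := hX.resolve_right fun h => absurd h.1 (not_le.2 hre)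
    obtain ⟨A, σ, hσ, hηA⟩ := hconv.resolve_left (not_le.2 hre)
    obtain ⟨C, hC, hk⟩ := exists_norm_fundSol_le_exp hn1 hl
    rw [max_eq_right (by linarith)] at hk
    set b := -lam.re with hb
    have hb0 : 0 < b := by linarith
    obtain ⟨B, hB⟩ := exists_enorm_le_dyadicKernel_add hn1 (k := fundSol lam)
      (G := fun t => Real.exp (b * t)) (IsGrowthRate.exp hb0.le).monotoneOn
      (IsGrowthRate.exp hb0.le).one_le hC hk
    obtain ⟨R, hR, hRX⟩ := exists_norm_sub_le_add_infDist hΩb hne hXb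
    obtain ⟨A', hA', hexp⟩ := exists_exp_decay_le_inv_pow (c := σ / 2) (by positivity) k
    refine ⟨fun t => Real.exp (σ / 2 * t), IsGrowthRate.exp (by positivity),
      ⟨max A 1 * A', by positivity, fun z => ?_⟩, min 1 (σ / (4 * b)), by positivity,
      min_le_left _ _, B * (Real.exp (b * R)).toNNReal,
      fun x hx => isKernelBound_of_growth (G := fun t => Real.exp (b * t)) ?_ hB fun y => ?_⟩
    · calc ‖η z‖ * Real.exp (σ / 2 * ‖z‖)
          ≤ max A 1 * Real.exp (-σ * ‖z‖) * Real.exp (σ / 2 * ‖z‖) := by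
            gcongr
            refine (hηA z).trans ?_
            gcongr
            exact le_max_left _ _
        _ = max A 1 * Real.exp (-(σ / 2 * ‖z‖)) := by
            rw [mul_assoc, ← Real.exp_add]; congr 2; ring
        _ ≤ max A 1 * (A' * ((1 + ‖z‖) ^ k)⁻¹) := by gcongr; exact hexp _ (norm_nonneg _)
        _ = _ := by ring
    · rw [← Real.toNNReal_one]; exact Real.toNNReal_mono (Real.one_le_exp (by positivity))
    · rw [Real.coe_toNNReal _ (by positivity), ← Real.exp_add]
      have hd : 0 ≤ infDist y (frontier Ω) := infDist_nonneg
      have h3 := hRX x hx y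
      set s₀ := min 1 (σ / (4 * b)) with hs₀
      have hs₀0 : 0 < s₀ := by positivity
      have h4 : s₀ * (4 * b) ≤ σ := by
        rw [← le_div_iff₀ (by positivity)]; exact min_le_right _ _
      have h5 : b * infDist y (frontier Ω) ≤ σ / 2 * (infDist y (frontier Ω) / (2 * s₀)) := by
        rw [← mul_div_assoc, le_div_iff₀ (by positivity)]
        nlinarith [mul_le_mul_of_nonneg_right h4 hd]
      refine Real.exp_le_exp.2 ?_
      nlinarith

lemma nonempty_frontier_of_isBounded {n : ℕ} (hn : 1 ≤ n) {Ω : Set (Euc n)}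
    (hb : Bornology.IsBounded Ω) (hne : Ω.Nonempty) : (frontier Ω).Nonempty := by
  have : Nonempty (Fin n) := ⟨⟨0, hn⟩⟩
  refine nonempty_frontier_iff.2 ⟨hne, ?_⟩
  rintro rfl
  exact NormedSpace.unbounded_univ ℝ (Euc n) hb

end

theorem theorem2p1 {n : ℕ} (N : ℕ) (hN : 2 ≤ N)
    (lam : ℂ) (hlam : lam = 0 ∨ lam ∈ Complex.slitPlane)
    (hn : 2 ≤ n ∨ (n = 1 ∧ lam ≠ 0))
    (Ω : Set (Euc n)) (hΩo : IsOpen Ω) (hΩb : Bornology.IsBounded Ω) (hΩn : Ω.Nonempty)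
    (hΩ : HasC2Boundary Ω)
    (η : 𝓢(Euc n, ℂ)) (hη : MomentCondition N η)
    -- for `Re lam < 0` the kernel grows exponentially and the halfspace integrals need this
    (hconv : 0 ≤ lam.re ∨ ∃ A : ℝ, ∃ σ > (0 : ℝ), ∀ x, ‖η x‖ ≤ A * Real.exp (-σ * ‖x‖))
    -- the set of evaluation points `x` over which the estimate is uniform
    (X : Set (Euc n))
    (hX : Bornology.IsBounded X ∨ (0 ≤ lam.re ∧ ¬ (n = 2 ∧ lam = 0)))
    (CE : ℝ≥0) :
    ∃ c₁ > (0 : ℝ), ∃ s₀ > (0 : ℝ), ∀ ε > (0 : ℝ), ∃ r₀ > (0 : ℝ), ∃ D₀ > (0 : ℝ),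
      ∀ r ≥ r₀, ∀ D ≥ D₀, ∀ h > (0 : ℝ), h * √D ≤ s₀ →
      -- the density `f`, and its continuation `F` to the whole space
      ∀ f F : Euc n → ℂ, ContDiffOn ℝ N f Ω → ContDiff ℝ N F → HasCompactSupport F →
        EqOn F f Ω → sobolevSupNorm N univ F ≤ CE * sobolevSupNorm N Ω f →
      ∀ P ν : (Fin n → ℤ) → Euc n, IsNearestBoundaryData Ω h P ν →
      ∀ x ∈ X,
        IntegrableOn (fun y => fundSol lam (x - y) * f y) Ω ∧
        (∀ m ∈ nodes Ω h D r,
          IntegrableOn (fun y => fundSol lam (x - y) * scaledShift η h D m y)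
            (halfSpace (P m) (ν m))) ∧
        ‖cubature lam Ω η F h D r P ν x - volPotential lam Ω f x‖ ≤
          (ε + c₁ * (h * √D) ^ 2) * (sobolevSupNorm N Ω f).toReal := by
  have hn1 : 1 ≤ n := by omega
  have hne := nonempty_frontier_of_isBounded hn1 hΩb hΩn
  obtain ⟨ω, hω, ⟨A, hA, hηω⟩, s₀, hs₀, hs₀1, B, hB⟩ :=
    exists_growthRate lam hlam hn Ω hΩb hne η hconv X hX (n + 1 + 2 * (n + 2))
  obtain ⟨c₁, hc₁, H⟩ := exists_cubature_error_le hn1 N hN lam Ω hΩo hΩb hΩn hΩ hne η hη X CE hω hA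
    hηω hs₀ hs₀1 hB
  refine ⟨c₁, hc₁, s₀, hs₀, fun ε hε => ?_⟩
  obtain ⟨r₀, hr₀, D₀, hD₀, H⟩ := H ε hε
  exact ⟨r₀, hr₀, D₀, hD₀, fun r hr D hD h hh hhD f F _ => H r hr D hD h hh hhD f F⟩
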